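/- Let $gl_{+\infty}$ be the Lie algebra of complex matrices $(a_{ij})_{i,j\ge 1}$ with finitely many non-zero entries, and let $E_{ij}$ be its matrix units. Let $\lambda=(\lambda_1,\lambda_2,\dots)$ be a sequence of complex numbers with finitely many non-zero terms, and put $|\lambda|=\sum_i\lambda_i$. Let $\mathrm{Par}^+$ be the set of those $\lambda$ that are non-increasing sequences of (necessarily non-negative) integers. Let $L^+(\lambda)$ be the irreducible $gl_{+\infty}$-module having a non-zero vector $v_\lambda$ with $E_{ij}v_\lambda=0$ for $i<j$ and $E_{ii}v_\lambda=\lambda_iv_\lambda$ for all $i$. Such a module exists. It has a unique gradation $L^+(\lambda)=\bigoplus_{k\ge 0}L^+(\lambda)_k$ (the principal gradation) such that $L^+(\lambda)_0=\mathbb{C}v_\lambda$ and $E_{ij}L^+(\lambda)_k\subset L^+(\lambda)_{k+i-j}$ for all $i,j,k$ (where $L^+(\lambda)_l=0$ for $l<0$), and all $L^+(\lambda)_k$ are finite-dimensional. Define $$\mathrm{growth}\,L^+(\lambda)=\limsup_{j\to\infty}\frac{\log\dim\bigoplus_{k\le j}L^+(\lambda)_k}{\log j}\in[0,\infty].$$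 (a) If $\lambda\in\mathrm{Par}^+$, then $\mathrm{growth}\,L^+(\lambda)=|\lambda|$. (b) If $\lambda\notin\mathrm{Par}^+$, then $\mathrm{growth}\,L^+(\lambda)=\infty$. These assertions hold for every module $L^+(\lambda)$ with the stated property. -/

import Mathlib

/-!
Rows, columns and sequence entries, numbered 1, 2, 3, … in the usual notation, are numbered
0, 1, 2, … here.  The condition `i < j` and the difference `i - j` do not depend on this.
-/

noncomputable section

attribute [local instance 100] LieRing.ofAssociativeRing

namespace GLInf

/-- The `(i, j)` entry of the matrix of an endomorphism of the space of column vectors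
`ℕ →₀ ℂ` with finitely many non-zero coordinates. -/
def entry (A : Module.End ℂ (ℕ →₀ ℂ)) (i j : ℕ) : ℂ := A (Finsupp.single j 1) i

/-- The matrix of the endomorphism has only finitely many non-zero entries. -/
def FinitelyManyEntries (A : Module.End ℂ (ℕ →₀ ℂ)) : Prop :=
  {p : ℕ × ℕ | entry A p.1 p.2 ≠ 0}.Finite

theorem FinitelyManyEntries.add {A B : Module.End ℂ (ℕ →₀ ℂ)}
    (hA : FinitelyManyEntries A) (hB : FinitelyManyEntries B) :
    FinitelyManyEntries (A + B) := by
  refine (Set.Finite.union hA hB).subset ?_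
  rintro ⟨i, j⟩ h
  by_contra hn
  simp only [Set.mem_union, Set.mem_ofPred_eq, not_or, not_not] at hn
  apply h
  have h1 := hn.1
  have h2 := hn.2
  simp only [entry] at h1 h2 ⊢
  simp [h1, h2]

theorem FinitelyManyEntries.smul (c : ℂ) {A : Module.End ℂ (ℕ →₀ ℂ)}
    (hA : FinitelyManyEntries A) : FinitelyManyEntries (c • A) := by
  refine Set.Finite.subset hA ?_
  rintro ⟨i, j⟩ h hn
  apply h
  simp only [entry] at hn ⊢
  simp [hn]

theorem entry_mul (A B : Module.End ℂ (ℕ →₀ ℂ)) (i j : ℕ) :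
    entry (A * B) i j = (B (Finsupp.single j 1)).sum fun k b => b * entry A i k := by
  have h : B (Finsupp.single j 1)
      = (B (Finsupp.single j 1)).sum fun k b => b • Finsupp.single k (1 : ℂ) := by
    conv_lhs => rw [← Finsupp.sum_single (B (Finsupp.single j 1))]
    simp
  simp only [entry, Module.End.mul_apply]
  conv_lhs => rw [h]
  simp only [Finsupp.sum, map_sum, map_smul, Finsupp.finsetSum_apply, Finsupp.smul_apply,
    smul_eq_mul]

theorem FinitelyManyEntries.mul {A B : Module.End ℂ (ℕ →₀ ℂ)}
    (hA : FinitelyManyEntries A) (hB : FinitelyManyEntries B) :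
    FinitelyManyEntries (A * B) := by
  refine ((hA.image Prod.fst).prod (hB.image Prod.snd)).subset ?_
  rintro ⟨i, j⟩ h
  have h' : entry (A * B) i j ≠ 0 := h
  rw [entry_mul] at h'
  obtain ⟨k, hk, hne⟩ := Finset.exists_ne_zero_of_sum_ne_zero h'
  exact ⟨⟨(i, k), right_ne_zero_of_mul hne, rfl⟩, ⟨(k, j), left_ne_zero_of_mul hne, rfl⟩⟩

/-- The Lie algebra `gl_{+∞}` of all complex matrices `(a_{ij})`, `i, j ∈ ℕ`, with finitely many
non-zero entries, under the commutator.  Such a matrix is regarded as the endomorphism of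
`ℕ →₀ ℂ` that it defines. -/
def gl : LieSubalgebra ℂ (Module.End ℂ (ℕ →₀ ℂ)) where
  carrier := {A | FinitelyManyEntries A}
  add_mem' hA hB := hA.add hB
  zero_mem' := by simp [FinitelyManyEntries, entry]
  smul_mem' c _ hA := hA.smul c
  lie_mem' {A B} hA hB := by
    change FinitelyManyEntries (A * B - B * A)
    have h := (hA.mul hB).add ((hB.mul hA).smul (-1))
    have e : A * B - B * A = A * B + (-1 : ℂ) • (B * A) := by
      ext
      simp [sub_eq_add_neg]
    rwa [e]

/-- The endomorphism whose `(i, j)` entry is `1` and whose other entries are `0`. -/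
def unitEnd (i j : ℕ) : Module.End ℂ (ℕ →₀ ℂ) := Finsupp.lsingle i ∘ₗ Finsupp.lapply j

theorem entry_unitEnd (i j k l : ℕ) :
    entry (unitEnd i j) k l = if k = i ∧ l = j then 1 else 0 := by
  simp only [entry, unitEnd, LinearMap.comp_apply, Finsupp.lapply_apply, Finsupp.lsingle_apply,
    Finsupp.single_apply]
  split_ifs <;> grind

/-- The matrix unit `E_{ij}`. -/
def E (i j : ℕ) : gl :=
  ⟨unitEnd i j, by
    refine (Set.finite_singleton (i, j)).subset ?_
    rintro ⟨k, l⟩ h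
    have h' : entry (unitEnd i j) k l ≠ 0 := h
    rw [entry_unitEnd] at h'
    by_contra hn
    exact h' (if_neg fun h2 => hn (by simp [h2.1, h2.2]))⟩

/-- `Par⁺`: the finitely supported sequences that are non-increasing sequences of integers
(they are then automatically non-negative). -/
def Par : Set (ℕ →₀ ℂ) :=
  {lam | ∃ μ : ℕ → ℤ, Antitone μ ∧ ∀ i, lam i = (μ i : ℂ)}

/-- `|λ|`, the sum of the entries of `λ`. -/
def size (lam : ℕ →₀ ℂ) : ℂ := lam.sum fun _ a => a

section Modules

variable {V : Type*} [AddCommGroup V] [Module ℂ V] [LieRingModule gl V]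

/-- `v` is a non-zero vector with `E_{ij} v = 0` for `i < j` and `E_{ii} v = λ_i v`. -/
structure IsHighestWeightVector (lam : ℕ →₀ ℂ) (v : V) : Prop where
  ne_zero : v ≠ 0
  raising : ∀ i j : ℕ, i < j → ⁅E i j, v⁆ = 0
  weight : ∀ i : ℕ, ⁅E i i, v⁆ = lam i • v

/-- `V = ⨁_{k ∈ ℕ} V_k` is a gradation with `V_0 = ℂ v` and `E_{ij} V_k ⊆ V_{k + i - j}`,
where `V_l = 0` for negative `l`. -/
structure IsPrincipalGradation (v : V) (G : ℕ → Submodule ℂ V) : Prop where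
  isInternal : DirectSum.IsInternal G
  zero_eq : G 0 = Submodule.span ℂ {v}
  lie_mem : ∀ i j k l : ℕ, k + i = l + j → ∀ x ∈ G k, ⁅E i j, x⁆ ∈ G l
  lie_eq_zero : ∀ i j k : ℕ, k + i < j → ∀ x ∈ G k, ⁅E i j, x⁆ = 0

end Modules

section Growth

variable {V : Type*} [AddCommGroup V] [Module ℂ V]

/-- The filtration `V_[j] = ⨁_{i ≤ j} V_i` associated to a gradation. -/
def filtration (G : ℕ → Submodule ℂ V) (j : ℕ) : Submodule ℂ V := ⨆ i ∈ Set.Iic j, G i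

/-- The growth `limsup_{j → ∞} log (dim V_[j]) / log j`, in the extended reals, of a filtration by
finite-dimensional subspaces. -/
def growth (F : ℕ → Submodule ℂ V) : EReal :=
  Filter.limsup
    (fun j : ℕ => ((Real.log (Module.finrank ℂ (F j)) / Real.log j : ℝ) : EReal)) Filter.atTop

end Growth

end GLInf

end

/-!
Write `f_i = E_{i+1,i}` and let `v` be a highest weight vector of an irreducible module `V`.

*The gradation.*  The span of all words `f_{i_1} ⋯ f_{i_k} v` is stable under every matrix unit, so
it is `V`, and the words of length `k` span the degree `k` part (`isPrincipalGradation_words`).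
Independence is seen on the operators `∑_{i < N} i E_{ii}`, which act on a word of length `k` by a
constant plus `k` once `N` is large (`degSpace`, `iSupIndep_degSpace`).  Every principal gradation
contains the words in the right degrees, which gives uniqueness.  If `λ_i = λ_{i+1}`, then `f_i v`
is singular and hence zero; so in a non-zero word of length `k` only finitely many letters occur,
and the graded parts are finite-dimensional (`finiteDimensional_words`).

*Lower bounds for the growth.*  If `w` has weight `μ`, the position `b` is beyond everything that
occurs in `w`, and `μ_i ≠ 0`, then `E_{ib} E_{bi} w = μ_i w`, so `E_{bi} w ≠ 0`: a unit of weight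
can be moved from `i` to `b`.  Moving `n` units to the elements of an `n`-element set `s` gives
vectors that are linearly independent for different `s`, and there are of order `j ^ n` sets with
sum of elements at most `j` (`pow_le_finrank`).  For `λ ∈ Par⁺` one can move `|λ|` units.  Outside
`Par⁺` one can move any number: from a coordinate `i` where `λ_i` is not a natural number, or,
when `λ_i < λ_{i+1}` are natural numbers, from the coordinate `i` of `f_i ^ (λ_i + 1) v`, where the
weight is `-1` (`growth_eq_top`).

*Upper bound for `λ ∈ Par⁺` and existence.*  The Lie algebra acts on polynomials in the entries
`x_{ia}` of a generic matrix by `E_{ij} = ∑_a x_{ia} ∂/∂x_{ja}`, and the leading principal minor of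
size `k` is a highest weight vector of weight `(1, …, 1, 0, …)` with `k` ones.  Hence
`∏_k Δ_{k+1} ^ (λ_k - λ_{k+1})` has weight `λ`.  When `λ ∈ Par⁺` this is a polynomial of degree
`n = |λ|`; words of length `k` applied to it have row indices growing at most like `k`, so the words
of length at most `j` lie in a space of dimension `O(j ^ n)`, and the submodule generated by the
pair of highest weight vectors in the product of `V` with the polynomials transfers the bound to `V`
(`finrank_filtration_le`).  For arbitrary complex `λ` the product is a formal expression,
but its logarithmic derivatives are rational functions, and they twist the action of `gl_{+∞}` on
the field of rational functions in such a way that `1` becomes a highest weight vector of weight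
`λ` (`exists_highestWeightVector`).  An irreducible quotient of the submodule generated by it is
the module sought (`exists_irreducible`).
-/

namespace GLInf

noncomputable section

attribute [local instance 100] LieRing.ofAssociativeRing

/-! ### Matrix units -/

theorem unitEnd_mul (i j k l : ℕ) :
    unitEnd i j * unitEnd k l = if j = k then unitEnd i l else 0 := by
  ext a b
  simp only [unitEnd]
  split_ifs with h <;> simp [Finsupp.single_apply, h, eq_comm]

theorem lie_E (i j k l : ℕ) :
    ⁅E i j, E k l⁆ = (if j = k then E i l else 0) - (if l = i then E k j else 0) := by
  apply Subtype.ext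
  have h : ((⁅E i j, E k l⁆ : gl) : Module.End ℂ (ℕ →₀ ℂ)) =
      unitEnd i j * unitEnd k l - unitEnd k l * unitEnd i j := rfl
  rw [h, unitEnd_mul, unitEnd_mul]
  split_ifs <;> rfl

theorem end_ext_entry {A B : Module.End ℂ (ℕ →₀ ℂ)} (h : ∀ i j, entry A i j = entry B i j) :
    A = B := by
  refine Finsupp.lhom_ext' fun j => LinearMap.ext_ring ?_
  ext i
  exact h i j

/-- The matrix units span `gl_{+∞}`, so a statement about all of `gl_{+∞}` that is linear in the
matrix only has to be checked on them. -/
theorem gl_induction {p : gl → Prop} (h0 : p 0) (hadd : ∀ A B, p A → p B → p (A + B))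
    (hE : ∀ (c : ℂ) i j, p (c • E i j)) (A : gl) : p A := by
  have hA : {p : ℕ × ℕ | entry A.1 p.1 p.2 ≠ 0}.Finite := A.2
  have key : A = ∑ q ∈ hA.toFinset, entry A.1 q.1 q.2 • E q.1 q.2 := by
    apply Subtype.ext
    have e : ((∑ q ∈ hA.toFinset, entry A.1 q.1 q.2 • E q.1 q.2 : gl) :
        Module.End ℂ (ℕ →₀ ℂ)) = ∑ q ∈ hA.toFinset, entry A.1 q.1 q.2 • unitEnd q.1 q.2 := by
      exact map_sum gl.incl _ _
    rw [e]
    apply end_ext_entry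
    intro i j
    have e2 : ∀ s : Finset (ℕ × ℕ),
        entry (∑ q ∈ s, entry A.1 q.1 q.2 • unitEnd q.1 q.2) i j =
          ∑ q ∈ s, entry A.1 q.1 q.2 * (if i = q.1 ∧ j = q.2 then 1 else 0) := by
      intro s
      simp only [← entry_unitEnd]
      simp [entry, Finsupp.finsetSum_apply]
    rw [e2, Finset.sum_eq_single (i, j)]
    · simp
    · rintro ⟨a, b⟩ _ hne
      rw [if_neg, mul_zero]
      rintro ⟨rfl, rfl⟩
      exact hne rfl
    · intro hn
      simpa using hn
  rw [key]
  exact Finset.sum_induction _ _ hadd h0 fun q _ => hE _ _ _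

/-- If the summands of an independent family contain submodules `W k`, then an element of the sum
of all `W k` that lies in one summand `G k` lies in `W k`. -/
theorem inf_iSup_le_of_iSupIndep {ι V : Type*} [AddCommGroup V] [Module ℂ V]
    {W G : ι → Submodule ℂ V} (hG : iSupIndep G)
    (h : W ≤ G) (k : ι) : G k ⊓ ⨆ j, W j ≤ W k := by
  have h1 : ⨆ j, W j ≤ W k ⊔ ⨆ j ≠ k, G j := by
    refine iSup_le fun j => ?_
    by_cases hj : j = k
    · subst hj
      exact le_sup_left
    · exact (h j).trans (le_sup_of_le_right (le_iSup₂_of_le j hj le_rfl))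
  calc G k ⊓ ⨆ j, W j ≤ (W k ⊔ ⨆ j ≠ k, G j) ⊓ G k := by
        rw [inf_comm]
        exact inf_le_inf_right _ h1
    _ ≤ W k ⊔ (⨆ j ≠ k, G j) ⊓ G k := (sup_inf_assoc_of_le _ (h k)).le
    _ = W k := by rw [inf_comm, (hG k).eq_bot, sup_bot_eq]

theorem lie_E_lie_E {V : Type*} [AddCommGroup V] [LieRingModule gl V] (i j k l : ℕ) (x : V) :
    ⁅E i j, ⁅E k l, x⁆⁆ = ⁅E k l, ⁅E i j, x⁆⁆ +
      ((if j = k then ⁅E i l, x⁆ else 0) - (if l = i then ⁅E k j, x⁆ else 0)) := by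
  rw [leibniz_lie, lie_E, sub_lie, add_comm]
  split_ifs <;> simp

section Modules

variable {V : Type*} [AddCommGroup V] [Module ℂ V] [LieRingModule gl V] [LieModule ℂ gl V]

/-- The action of `E_{ij}` as a linear map. -/
abbrev act (V : Type*) [AddCommGroup V] [Module ℂ V] [LieRingModule gl V] [LieModule ℂ gl V]
    (i j : ℕ) : V →ₗ[ℂ] V := LieModule.toEnd ℂ gl V (E i j)

/-- A submodule stable under all matrix units, as a Lie submodule. -/
def lieSubmoduleOfStable (U : Submodule ℂ V) (h : ∀ i j, ∀ x ∈ U, ⁅E i j, x⁆ ∈ U) :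
    LieSubmodule ℂ gl V where
  __ := U
  lie_mem {A x} hx := by
    refine gl_induction (p := fun A => ⁅A, x⁆ ∈ U) ?_ ?_ ?_ A
    · simp
    · intro A B hA hB
      rw [add_lie]
      exact U.add_mem hA hB
    · intro c i j
      rw [smul_lie]
      exact U.smul_mem c (h i j x hx)

theorem eq_top_of_stable [LieModule.IsIrreducible ℂ gl V] (U : Submodule ℂ V)
    (h : ∀ i j, ∀ x ∈ U, ⁅E i j, x⁆ ∈ U) {u : V} (hu : u ∈ U) (hu0 : u ≠ 0) : U = ⊤ := by
  rcases eq_bot_or_eq_top (lieSubmoduleOfStable U h) with h1 | h1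
  · have : u ∈ lieSubmoduleOfStable U h := hu
    rw [h1] at this
    exact absurd ((LieSubmodule.mem_bot _).1 this) hu0
  · have := congrArg LieSubmodule.toSubmodule h1
    exact this

/-! ### The degree operators -/

/-- The operator `∑_{i < N} i E_{ii}`.  The full sum over all `i`, which measures the principal
degree, does not lie in `gl_{+∞}`. -/
def degOp (V : Type*) [AddCommGroup V] [Module ℂ V] [LieRingModule gl V] [LieModule ℂ gl V]
    (N : ℕ) : V →ₗ[ℂ] V := ∑ i ∈ Finset.range N, (i : ℂ) • act V i i

theorem degOp_apply (N : ℕ) (x : V) :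
    degOp V N x = ∑ i ∈ Finset.range N, (i : ℂ) • ⁅E i i, x⁆ := by
  simp [degOp]

theorem degOp_lie {N i j : ℕ} (hi : i < N) (hj : j < N) (x : V) :
    degOp V N ⁅E i j, x⁆ = ⁅E i j, degOp V N x⁆ + ((i : ℂ) - j) • ⁅E i j, x⁆ := by
  simp only [degOp_apply, lie_sum, lie_smul, lie_E_lie_E _ _ i j]
  simp only [smul_add, Finset.sum_add_distrib, add_right_inj, smul_sub, Finset.sum_sub_distrib,
    smul_ite, smul_zero]
  simp [hi, hj, sub_smul]

/-- The vectors on which the operators `∑_{i < N} i E_{ii}` act by `c` for all large `N`. -/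
def degSpace (V : Type*) [AddCommGroup V] [Module ℂ V] [LieRingModule gl V] [LieModule ℂ gl V]
    (c : ℂ) : Submodule ℂ V where
  carrier := {x | ∀ᶠ N in Filter.atTop, degOp V N x = c • x}
  add_mem' {x y} hx hy := by
    filter_upwards [hx, hy] with N h1 h2
    rw [map_add, h1, h2, smul_add]
  zero_mem' := by simp
  smul_mem' a x hx := by
    filter_upwards [hx] with N h1
    rw [map_smul, h1, smul_comm]

theorem mem_degSpace {c : ℂ} {x : V} :
    x ∈ degSpace V c ↔ ∀ᶠ N in Filter.atTop, degOp V N x = c • x := Iff.rfl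

theorem lie_mem_degSpace {c c' : ℂ} {x : V} (hx : x ∈ degSpace V c) (i j : ℕ)
    (h : c' = c + (i - j)) : ⁅E i j, x⁆ ∈ degSpace V c' := by
  rw [mem_degSpace] at hx ⊢
  filter_upwards [hx, Filter.eventually_gt_atTop i, Filter.eventually_gt_atTop j] with N h1 hi hj
  rw [degOp_lie hi hj, h1, lie_smul, h, add_smul]

theorem iSupIndep_degSpace : iSupIndep (degSpace V) := by
  rw [iSupIndep_iff_finsetSum_eq_zero_imp_eq_zero]
  intro s x hx h0
  have h : ∀ᶠ N in Filter.atTop, ∀ c ∈ s, degOp V N (x c) = c • x c :=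
    (Finset.eventually_all s).2 hx
  obtain ⟨N, hN⟩ := h.exists
  exact (iSupIndep_iff_finsetSum_eq_zero_imp_eq_zero _).1
    (Module.End.eigenspaces_iSupIndep (degOp V N)) s x
    (fun c hc => Module.End.mem_eigenspace_iff.2 (hN c hc)) h0

/-- The degree of a highest weight vector of weight `λ` under `∑ i E_{ii}`. -/
def topDeg (lam : ℕ →₀ ℂ) : ℂ := lam.sum fun i a => (i : ℂ) * a

theorem IsHighestWeightVector.mem_degSpace {lam : ℕ →₀ ℂ} {v : V}
    (hv : IsHighestWeightVector lam v) : v ∈ degSpace V (topDeg lam) := by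
  obtain ⟨M, hM⟩ := lam.support.exists_nat_subset_range
  rw [GLInf.mem_degSpace]
  filter_upwards [Filter.eventually_ge_atTop M] with N hN
  rw [degOp_apply, topDeg, Finsupp.sum_of_support_subset _
    (hM.trans (Finset.range_subset_range.2 hN)) _ (by simp), Finset.sum_smul]
  simp [hv.weight, smul_smul]

/-! ### The principal gradation -/

/-- The span of the vectors `f_{i_1} ⋯ f_{i_k} v`, where `f_i = E_{i+1,i}`. -/
def words (v : V) : ℕ → Submodule ℂ V
  | 0 => Submodule.span ℂ {v}
  | k + 1 => ⨆ i, (words v k).map (act V (i + 1) i)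

theorem lie_mem_words_succ {v x : V} {k : ℕ} (hx : x ∈ words v k) (i : ℕ) :
    ⁅E (i + 1) i, x⁆ ∈ words v (k + 1) :=
  Submodule.mem_iSup_of_mem i ⟨x, hx, rfl⟩

theorem words_succ_le {v : V} {k : ℕ} {U : Submodule ℂ V}
    (h : ∀ i, ∀ x ∈ words v k, ⁅E (i + 1) i, x⁆ ∈ U) : words v (k + 1) ≤ U := by
  refine iSup_le fun i => ?_
  rintro _ ⟨x, hx, rfl⟩
  exact h i x hx

theorem words_le_degSpace {v : V} {c : ℂ} (hv : v ∈ degSpace V c) (k : ℕ) :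
    words v k ≤ degSpace V (c + k) := by
  induction k with
  | zero => simpa [words] using hv
  | succ k ih =>
    refine words_succ_le fun i x hx => ?_
    refine lie_mem_degSpace (ih hx) _ _ ?_
    push_cast
    ring

theorem iSupIndep_words {v : V} {c : ℂ} (hv : v ∈ degSpace V c) : iSupIndep (words v) := by
  have h : iSupIndep fun k : ℕ => degSpace V (c + k) :=
    iSupIndep_degSpace.comp fun a b hab => by simpa using hab
  exact h.mono (words_le_degSpace hv)

theorem lie_diag_mem_words {lam : ℕ →₀ ℂ} {v : V} (hv : IsHighestWeightVector lam v) (i k : ℕ) :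
    ∀ x ∈ words v k, ⁅E i i, x⁆ ∈ words v k := by
  induction k with
  | zero =>
    intro x hx
    obtain ⟨a, rfl⟩ := Submodule.mem_span_singleton.1 hx
    rw [lie_smul, hv.weight]
    exact Submodule.smul_mem _ _ (Submodule.smul_mem _ _ (Submodule.mem_span_singleton_self v))
  | succ k ih =>
    intro x hx
    refine words_succ_le (U := (words v (k + 1)).comap (act V i i)) (fun j y hy => ?_) hx
    change ⁅E i i, ⁅E (j + 1) j, y⁆⁆ ∈ words v (k + 1)
    have hf := lie_mem_words_succ hy
    rw [lie_E_lie_E]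
    refine Submodule.add_mem _ (lie_mem_words_succ (ih y hy) j) (Submodule.sub_mem _ ?_ ?_)
    · split_ifs with h
      · subst h
        exact hf j
      · exact zero_mem _
    · split_ifs with h
      · subst h
        exact hf j
      · exact zero_mem _

/-- The spaces of words, extended by zero to negative degrees. -/
def wordsZ (v : V) (k : ℤ) : Submodule ℂ V := if k < 0 then ⊥ else words v k.toNat

theorem wordsZ_natCast (v : V) (k : ℕ) : wordsZ v k = words v k := by simp [wordsZ]

theorem wordsZ_of_neg (v : V) {k : ℤ} (h : k < 0) : wordsZ v k = ⊥ := by simp [wordsZ, h]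

theorem lie_raise_mem_wordsZ {lam : ℕ →₀ ℂ} {v : V} (hv : IsHighestWeightVector lam v)
    (i k : ℕ) : ∀ x ∈ words v k, ⁅E i (i + 1), x⁆ ∈ wordsZ v (k - 1) := by
  induction k with
  | zero =>
    intro x hx
    obtain ⟨a, rfl⟩ := Submodule.mem_span_singleton.1 hx
    rw [lie_smul, hv.raising i (i + 1) (Nat.lt_succ_self i), smul_zero]
    exact zero_mem _
  | succ k ih =>
    have e : ((k + 1 : ℕ) : ℤ) - 1 = k := by push_cast; ring
    rw [e, wordsZ_natCast]
    intro x hx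
    refine words_succ_le (U := (words v k).comap (act V i (i + 1))) (fun j y hy => ?_) hx
    change ⁅E i (i + 1), ⁅E (j + 1) j, y⁆⁆ ∈ words v k
    rw [lie_E_lie_E]
    refine Submodule.add_mem _ ?_ (Submodule.sub_mem _ ?_ ?_)
    · have h1 := ih y hy
      rcases k with _ | k
      · rw [wordsZ_of_neg _ (by norm_num)] at h1
        rw [(Submodule.mem_bot ℂ).1 h1, lie_zero]
        exact zero_mem _
      · have e : ((k + 1 : ℕ) : ℤ) - 1 = k := by push_cast; ring
        rw [e, wordsZ_natCast] at h1
        exact lie_mem_words_succ h1 j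
    · split_ifs with h
      · obtain rfl : i = j := by omega
        exact lie_diag_mem_words hv _ _ y hy
      · exact zero_mem _
    · split_ifs with h
      · subst h
        exact lie_diag_mem_words hv _ _ y hy
      · exact zero_mem _

theorem lie_lie_mem_wordsZ {v : V} {A B : gl} {a b : ℤ}
    (hA : ∀ k, ∀ x ∈ wordsZ v k, ⁅A, x⁆ ∈ wordsZ v (k + a))
    (hB : ∀ k, ∀ x ∈ wordsZ v k, ⁅B, x⁆ ∈ wordsZ v (k + b)) :
    ∀ k, ∀ x ∈ wordsZ v k, ⁅⁅A, B⁆, x⁆ ∈ wordsZ v (k + (a + b)) := by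
  intro k x hx
  rw [lie_lie]
  refine Submodule.sub_mem _ ?_ ?_
  · have := hA _ _ (hB k x hx)
    rwa [add_assoc, add_comm b] at this
  · have := hB _ _ (hA k x hx)
    rwa [add_assoc] at this

/-- The words are stable under all matrix units, which shift the length `k` by `i - j`.  This holds
for `j = i`, `j = i ± 1` by induction on the length, and these generate the other matrix units under
brackets. -/
theorem lie_mem_wordsZ {lam : ℕ →₀ ℂ} {v : V} (hv : IsHighestWeightVector lam v) (i j : ℕ) :
    ∀ k, ∀ x ∈ wordsZ v k, ⁅E i j, x⁆ ∈ wordsZ v (k + (i - j)) := by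
  have nat {A : gl} {a : ℤ} (h : ∀ k : ℕ, ∀ x ∈ words v k, ⁅A, x⁆ ∈ wordsZ v (k + a)) :
      ∀ k : ℤ, ∀ x ∈ wordsZ v k, ⁅A, x⁆ ∈ wordsZ v (k + a) := by
    intro k x hx
    rcases lt_or_ge k 0 with hk | hk
    · rw [wordsZ_of_neg _ hk] at hx
      rw [(Submodule.mem_bot ℂ).1 hx, lie_zero]
      exact zero_mem _
    · lift k to ℕ using hk
      rw [wordsZ_natCast] at hx
      exact h k x hx
  have diag : ∀ i : ℕ, ∀ k, ∀ x ∈ wordsZ v k, ⁅E i i, x⁆ ∈ wordsZ v (k + 0) := fun i =>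
    nat fun k x hx => by
      rw [add_zero, wordsZ_natCast]
      exact lie_diag_mem_words hv i k x hx
  have up1 : ∀ i k, ∀ x ∈ wordsZ v k, ⁅E i (i + 1), x⁆ ∈ wordsZ v (k + -1) := fun i =>
    nat fun k x hx => lie_raise_mem_wordsZ hv i k x hx
  have up : ∀ d i : ℕ, ∀ k, ∀ x ∈ wordsZ v k,
      ⁅E i (i + (d + 1)), x⁆ ∈ wordsZ v (k + -((d : ℤ) + 1)) := by
    intro d
    induction d with
    | zero => simpa using up1
    | succ d ih =>
      intro i
      have h := lie_lie_mem_wordsZ (ih i) (up1 (i + (d + 1)))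
      rw [lie_E, if_pos rfl, if_neg (by omega), sub_zero] at h
      convert h using 3
      push_cast
      ring_nf
  have down1 : ∀ i k, ∀ x ∈ wordsZ v k, ⁅E (i + 1) i, x⁆ ∈ wordsZ v (k + 1) := fun i =>
    nat fun k x hx => by
      have e : (k : ℤ) + 1 = (k + 1 : ℕ) := by push_cast; ring
      rw [e, wordsZ_natCast]
      exact lie_mem_words_succ hx i
  have down : ∀ d i : ℕ, ∀ k, ∀ x ∈ wordsZ v k,
      ⁅E (i + (d + 1)) i, x⁆ ∈ wordsZ v (k + ((d : ℤ) + 1)) := by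
    intro d
    induction d with
    | zero => simpa using down1
    | succ d ih =>
      intro i
      have h := lie_lie_mem_wordsZ (down1 (i + (d + 1))) (ih i)
      rw [lie_E, if_pos rfl, if_neg (by omega), sub_zero] at h
      convert h using 3
      push_cast
      ring_nf
  intro k x hx
  rcases lt_trichotomy i j with h | rfl | h
  · obtain ⟨d, rfl⟩ := Nat.exists_eq_add_of_lt h
    have := up d i k x hx
    rw [add_assoc]
    convert this using 2
    push_cast
    ring
  · simpa using diag i k x hx
  · obtain ⟨d, rfl⟩ := Nat.exists_eq_add_of_lt h
    have := down d j k x hx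
    rw [add_assoc]
    convert this using 2
    push_cast
    ring

theorem lie_mem_words {lam : ℕ →₀ ℂ} {v : V} (hv : IsHighestWeightVector lam v) {i j k l : ℕ}
    (h : k + i = l + j) {x : V} (hx : x ∈ words v k) : ⁅E i j, x⁆ ∈ words v l := by
  rw [← wordsZ_natCast] at hx ⊢
  convert lie_mem_wordsZ hv i j k x hx using 2
  omega

theorem lie_eq_zero_of_mem_words {lam : ℕ →₀ ℂ} {v : V} (hv : IsHighestWeightVector lam v)
    {i j k : ℕ} (h : k + i < j) {x : V} (hx : x ∈ words v k) : ⁅E i j, x⁆ = 0 := by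
  rw [← wordsZ_natCast] at hx
  have h1 := lie_mem_wordsZ hv i j k x hx
  rw [wordsZ_of_neg _ (by omega)] at h1
  exact (Submodule.mem_bot ℂ).1 h1

theorem lie_mem_iSup_words {lam : ℕ →₀ ℂ} {v : V} (hv : IsHighestWeightVector lam v) (i j : ℕ) :
    ∀ x ∈ ⨆ k, words v k, ⁅E i j, x⁆ ∈ ⨆ k, words v k := by
  intro x hx
  refine (iSup_le fun k y hy => ?_ : ⨆ k, words v k ≤ (⨆ k, words v k).comap (act V i j)) hx
  change ⁅E i j, y⁆ ∈ ⨆ k, words v k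
  by_cases h : k + i < j
  · rw [lie_eq_zero_of_mem_words hv h hy]
    exact zero_mem _
  · exact Submodule.mem_iSup_of_mem (k + i - j) (lie_mem_words hv (by omega) hy)

theorem mem_words_zero (v : V) : v ∈ words v 0 := Submodule.mem_span_singleton_self v

theorem iSup_words_eq_top [LieModule.IsIrreducible ℂ gl V] {lam : ℕ →₀ ℂ} {v : V}
    (hv : IsHighestWeightVector lam v) : ⨆ k, words v k = ⊤ :=
  eq_top_of_stable _ (lie_mem_iSup_words hv) (Submodule.mem_iSup_of_mem 0 (mem_words_zero v))
    hv.ne_zero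

/-- The words of length `k` in the `E_{i+1,i}` applied to the highest weight vector span the
degree `k` part of the principal gradation. -/
theorem isPrincipalGradation_words [LieModule.IsIrreducible ℂ gl V] {lam : ℕ →₀ ℂ} {v : V}
    (hv : IsHighestWeightVector lam v) : IsPrincipalGradation v (words v) where
  isInternal := (DirectSum.isInternal_submodule_iff_iSupIndep_and_iSup_eq_top _).2
    ⟨iSupIndep_words hv.mem_degSpace, iSup_words_eq_top hv⟩
  zero_eq := rfl
  lie_mem _ _ _ _ h _ hx := lie_mem_words hv h hx
  lie_eq_zero _ _ _ h _ hx := lie_eq_zero_of_mem_words hv h hx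

/-- A principal gradation contains the words of length `k` in degree `k`; since the words span the
module, there is no room for anything else. -/
theorem IsPrincipalGradation.eq_words [LieModule.IsIrreducible ℂ gl V] {lam : ℕ →₀ ℂ} {v : V}
    (hv : IsHighestWeightVector lam v) {G : ℕ → Submodule ℂ V} (hG : IsPrincipalGradation v G) :
    G = words v := by
  have h : words v ≤ G := by
    intro k
    induction k with
    | zero => rw [hG.zero_eq]; rfl
    | succ k ih =>
      exact words_succ_le fun i x hx => hG.lie_mem (i + 1) i k (k + 1) (by ring) x (ih hx)
  funext k
  refine le_antisymm ?_ (h k)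
  have := inf_iSup_le_of_iSupIndep hG.isInternal.submodule_iSupIndep h k
  rwa [iSup_words_eq_top hv, inf_top_eq] at this

/-! ### Finite-dimensionality of the graded parts -/

/-- If `λ_i = λ_{i+1}`, then `E_{i+1,i} v` is annihilated by all raising operators; it generates a
submodule living in positive degrees, and so it vanishes. -/
theorem lowering_eq_zero [LieModule.IsIrreducible ℂ gl V] {lam : ℕ →₀ ℂ} {v : V}
    (hv : IsHighestWeightVector lam v) {i : ℕ} (hi : lam i = lam (i + 1)) :
    ⁅E (i + 1) i, v⁆ = 0 := by
  by_contra hu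
  have hw : IsHighestWeightVector (lam - Finsupp.single i 1 + Finsupp.single (i + 1) 1)
      ⁅E (i + 1) i, v⁆ := by
    refine ⟨hu, fun a b hab => ?_, fun a => ?_⟩
    · rw [lie_E_lie_E, hv.raising a b hab, lie_zero, zero_add]
      by_cases hb : b = i + 1 <;> by_cases ha : i = a
      · subst hb ha
        simp [hv.weight, hi]
      · rw [if_pos hb, if_neg ha, hv.raising a i (by omega), sub_zero]
      · rw [if_neg hb, if_pos ha, hv.raising (i + 1) b (by omega), sub_zero]
      · rw [if_neg hb, if_neg ha, sub_zero]
    · rw [lie_E_lie_E, hv.weight, lie_smul]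
      simp only [Finsupp.add_apply, Finsupp.sub_apply, Finsupp.single_apply, add_smul, sub_smul,
        ite_smul, one_smul, zero_smul]
      by_cases ha : a = i + 1 <;> by_cases ha' : i = a
      · omega
      · subst ha
        simp
      · subst ha'
        simp [sub_eq_add_neg]
      · simp [ha, ha', Ne.symm ha]
  have hdeg : ⁅E (i + 1) i, v⁆ ∈ degSpace V (topDeg lam + 1) :=
    lie_mem_degSpace hv.mem_degSpace _ _ (by push_cast; ring)
  have hle : ⨆ k, words ⁅E (i + 1) i, v⁆ k ≤ ⨆ c ≠ topDeg lam, degSpace V c := by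
    refine iSup_le fun k => (words_le_degSpace hdeg k).trans ?_
    refine le_iSup₂_of_le (topDeg lam + 1 + k) ?_ le_rfl
    intro h
    have h2 : ((k + 1 : ℕ) : ℂ) = 0 := by
      push_cast
      linear_combination h
    exact Nat.succ_ne_zero k (Nat.cast_eq_zero.1 h2)
  rw [iSup_words_eq_top hw] at hle
  exact hv.ne_zero (Submodule.disjoint_def.1 (iSupIndep_degSpace (topDeg lam)) v hv.mem_degSpace
    (hle Submodule.mem_top))

/-- A letter `f_i` with `i` at least two beyond all letters of a word commutes with them and reaches
the highest weight vector, which it kills. -/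
theorem lowering_words_eq_zero [LieModule.IsIrreducible ℂ gl V] {lam : ℕ →₀ ℂ} {v : V}
    (hv : IsHighestWeightVector lam v) {m : ℕ} (hm : ∀ i, m ≤ i → lam i = 0) (k : ℕ) :
    ∀ i, m + k ≤ i → ∀ x ∈ words v k, ⁅E (i + 1) i, x⁆ = 0 := by
  induction k with
  | zero =>
    intro i hi x hx
    obtain ⟨a, rfl⟩ := Submodule.mem_span_singleton.1 hx
    rw [lie_smul, lowering_eq_zero hv (by rw [hm i hi, hm (i + 1) (by omega)]), smul_zero]
  | succ k ih =>
    intro i hi x hx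
    refine words_succ_le (U := LinearMap.ker (act V (i + 1) i)) (fun j y hy => ?_) hx
    change ⁅E (i + 1) i, ⁅E (j + 1) j, y⁆⁆ = 0
    by_cases hj : m + k ≤ j
    · rw [ih j hj y hy, lie_zero]
    · rw [lie_E_lie_E, ih i (by omega) y hy, lie_zero, if_neg (by omega), if_neg (by omega)]
      simp

theorem finiteDimensional_words [LieModule.IsIrreducible ℂ gl V] {lam : ℕ →₀ ℂ} {v : V}
    (hv : IsHighestWeightVector lam v) (k : ℕ) : FiniteDimensional ℂ (words v k) := by
  obtain ⟨m, hm⟩ := lam.support.exists_nat_subset_range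
  have hm' : ∀ i, m ≤ i → lam i = 0 := by
    intro i hi
    by_contra h
    have := Finset.mem_range.1 (hm (Finsupp.mem_support_iff.2 h))
    omega
  induction k with
  | zero => exact inferInstanceAs (FiniteDimensional ℂ (Submodule.span ℂ {v}))
  | succ k ih =>
    have hle : words v (k + 1) ≤ ⨆ i : Fin (m + k), (words v k).map (act V (i + 1) i) := by
      refine words_succ_le fun i x hx => ?_
      by_cases hi : m + k ≤ i
      · rw [lowering_words_eq_zero hv hm' k i hi x hx]
        exact zero_mem _
      · exact Submodule.mem_iSup_of_mem ⟨i, by omega⟩ ⟨x, hx, rfl⟩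
    exact Submodule.finiteDimensional_of_le hle

theorem filtration_words_finite [LieModule.IsIrreducible ℂ gl V] {lam : ℕ →₀ ℂ} {v : V}
    (hv : IsHighestWeightVector lam v) (j : ℕ) :
    FiniteDimensional ℂ (filtration (words v) j) := by
  have := finiteDimensional_words hv
  have e : filtration (words v) j = ⨆ i : Set.Iic j, words v i := by
    rw [filtration, iSup_subtype']
  rw [e]
  infer_instance

theorem words_le_filtration {v : V} {k j : ℕ} (h : k ≤ j) : words v k ≤ filtration (words v) j :=
  le_iSup₂_of_le k h le_rfl

/-! ### Moving units of weight to new positions -/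

/-- A vector `w` of weight `μ` is bounded by `m` if `μ` vanishes from `m` on and `w` is
annihilated by the raising operators `E_{xa}` with `a ≥ m`. -/
structure IsBoundedWeightVector (μ : ℕ → ℂ) (m : ℕ) (w : V) : Prop where
  ne_zero : w ≠ 0
  weight : ∀ i, ⁅E i i, w⁆ = μ i • w
  weight_eq_zero : ∀ i, m ≤ i → μ i = 0
  raising : ∀ x a, x < a → m ≤ a → ⁅E x a, w⁆ = 0

theorem lie_weight {μ : ℕ → ℂ} {w : V} (hw : ∀ i, ⁅E i i, w⁆ = μ i • w) (a b i : ℕ) :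
    ⁅E i i, ⁅E a b, w⁆⁆ = (μ i + (if i = a then 1 else 0) - (if i = b then 1 else 0)) •
      ⁅E a b, w⁆ := by
  rw [lie_E_lie_E, hw, lie_smul, sub_smul, add_smul, add_sub_assoc]
  congr 2
  · split_ifs with h
    · rw [h, one_smul]
    · rw [zero_smul]
  · by_cases h : b = i
    · rw [if_pos h, if_pos h.symm, one_smul, h]
    · rw [if_neg h, if_neg (Ne.symm h), zero_smul]

/-- Moving one unit of weight from a coordinate `i` with `μ_i ≠ 0` to a new coordinate `b` beyond
the bound: `E_{ib} E_{bi} w = μ_i w`, so that `E_{bi} w` does not vanish. -/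
theorem IsBoundedWeightVector.step {μ : ℕ → ℂ} {m b i : ℕ} {w : V}
    (hw : IsBoundedWeightVector μ m w) (hb : m ≤ b) (hi : i < b) (h0 : μ i ≠ 0) :
    IsBoundedWeightVector
      (fun j => μ j + (if j = b then 1 else 0) - (if j = i then 1 else 0)) (b + 1)
      ⁅E b i, w⁆ := by
  refine ⟨fun h => ?_, lie_weight hw.weight b i, fun j hj => ?_, fun x a hxa ha => ?_⟩
  · have h1 : ⁅E i b, ⁅E b i, w⁆⁆ = μ i • w := by
      rw [lie_E_lie_E, hw.raising i b hi hb, if_pos rfl, if_pos rfl, hw.weight, hw.weight,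
        hw.weight_eq_zero b hb]
      simp
    rw [h, lie_zero] at h1
    exact smul_ne_zero h0 hw.ne_zero h1.symm
  · have h1 : μ j = 0 := hw.weight_eq_zero j (by omega)
    simp [h1, show j ≠ b by omega, show j ≠ i by omega]
  · rw [lie_E_lie_E, hw.raising x a hxa (by omega), if_neg (by omega : a ≠ b), lie_zero,
      hw.raising b a (by omega) (by omega)]
    simp

/-- From the weight `μ` one can take away `n` units, one after the other, always from a coordinate
below `m` that is non-zero at that moment.  This is what `n` applications of
`IsBoundedWeightVector.step` need. -/
def Movable (m : ℕ) : ℕ → (ℕ → ℂ) → Prop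
  | 0, _ => True
  | n + 1, μ => ∃ i < m, μ i ≠ 0 ∧ Movable m n fun j => μ j - if j = i then 1 else 0

/-- One unit of weight can be moved to each of the positions in `s`, in increasing order.  Below `m`
the resulting weight `ν` is left unspecified. -/
theorem exists_moved_vector {lam : ℕ →₀ ℂ} {v w : V} (hv : IsHighestWeightVector lam v)
    {μ : ℕ → ℂ} {m n d : ℕ} (hw : IsBoundedWeightVector μ m w) (hd : w ∈ words v d)
    (hmov : Movable m n μ) (s : Finset ℕ) (hs : ∀ a ∈ s, m ≤ a) (hn : s.card ≤ n) :
    ∃ (u : V) (ν : ℕ → ℂ) (M k : ℕ),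
      IsBoundedWeightVector (fun j => if j < m then ν j else if j ∈ s then 1 else 0) M u ∧
      (∀ b, m ≤ b → (∀ a ∈ s, a < b) → M ≤ b) ∧ Movable m (n - s.card) ν ∧
      u ∈ words v k ∧ k ≤ d + ∑ a ∈ s, a := by
  induction s using Finset.induction_on_max with
  | empty =>
    refine ⟨w, μ, m, d, ?_, fun b hb _ => hb, by simpa using hmov, hd, by simp⟩
    convert hw using 1
    funext j
    split_ifs with h h'
    · rfl
    · simp at h'
    · exact (hw.weight_eq_zero j (by omega)).symm
  | insert b s hbs ih =>
    have hb : b ∉ s := fun h => lt_irrefl _ (hbs b h)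
    rw [Finset.card_insert_of_notMem hb] at hn
    obtain ⟨u, ν, M, k, hu, hM, hν, huk, hk⟩ :=
      ih (fun a ha => hs a (Finset.mem_insert_of_mem ha)) (by omega)
    have hmb : m ≤ b := hs b (Finset.mem_insert_self b s)
    -- The largest element `b` is treated last: it is beyond the bound `M` of the vector `u`
    -- constructed for `s`.
    obtain ⟨e, he⟩ : ∃ e, n - s.card = e + 1 := ⟨n - s.card - 1, by omega⟩
    rw [he] at hν
    obtain ⟨i, hi, hi0, hν'⟩ := hν
    have hstep := hu.step (b := b) (i := i) (hM b hmb hbs) (by omega) (by simpa [hi] using hi0)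
    refine ⟨⁅E b i, u⁆, fun j => ν j - if j = i then 1 else 0, b + 1, k + b - i, ?_, ?_, ?_, ?_, ?_⟩
    · convert hstep using 1
      funext j
      by_cases hj : j < m
      · simp [hj, show j ≠ b by omega]
      · by_cases hjb : j = b
        · subst hjb
          simp [hj, hb, show j ≠ i by omega]
        · simp [hj, hjb, show j ≠ i by omega]
    · intro c _ hc
      exact hc b (Finset.mem_insert_self b s)
    · rw [Finset.card_insert_of_notMem hb]
      convert hν' using 1
      omega
    · exact lie_mem_words hv (by omega) huk
    · rw [Finset.sum_insert hb]
      omega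

theorem sum_two_pow_injective : Function.Injective fun s : Finset ℕ => ∑ i ∈ s, 2 ^ i := by
  intro s t h
  have := congrArg (fun n : ℕ => n.bitIndices.toFinset) h
  simpa using this

/-- The vectors of `exists_moved_vector` for different sets `s` are separated by the eigenvalues
`∑_{a ∈ s} 2^a` of `∑_i 2^i E_{ii}`. -/
theorem choose_le_finrank [LieModule.IsIrreducible ℂ gl V] {lam : ℕ →₀ ℂ} {v w : V}
    (hv : IsHighestWeightVector lam v) {μ : ℕ → ℂ} {m n d : ℕ}
    (hw : IsBoundedWeightVector μ m w) (hd : w ∈ words v d) (hmov : Movable m n μ) {R j : ℕ}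
    (hj : d + n * R ≤ j) :
    (R - m).choose n ≤ Module.finrank ℂ (filtration (words v) j) := by
  have := filtration_words_finite hv j
  have hS (s : (Finset.Ico m R).powersetCard n) : (s : Finset ℕ) ⊆ Finset.Ico m R ∧
      (s : Finset ℕ).card = n := Finset.mem_powersetCard.1 s.2
  have key (s : (Finset.Ico m R).powersetCard n) : ∃ u ∈ filtration (words v) j, u ≠ 0 ∧
      (∑ i ∈ Finset.Ico m R, (2 : ℂ) ^ i • act V i i) u =
        ((∑ i ∈ (s : Finset ℕ), 2 ^ i : ℕ) : ℂ) • u := by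
    obtain ⟨hsub, hcard⟩ := hS s
    obtain ⟨u, ν, M, k, hu, -, -, huk, hk⟩ := exists_moved_vector hv hw hd hmov s
      (fun a ha => (Finset.mem_Ico.1 (hsub ha)).1) hcard.le
    refine ⟨u, words_le_filtration ?_ huk, hu.ne_zero, ?_⟩
    · refine hk.trans (le_trans (Nat.add_le_add_left ?_ d) hj)
      have := Finset.sum_le_card_nsmul (s : Finset ℕ) (fun a => a) R
        fun a ha => (Finset.mem_Ico.1 (hsub ha)).2.le
      simpa [hcard] using this
    · have h1 : ∀ i ∈ Finset.Ico m R, ((2 : ℂ) ^ i • act V i i) u =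
          (if i ∈ (s : Finset ℕ) then (2 : ℂ) ^ i else 0) • u := by
        intro i hi
        have hi' := (Finset.mem_Ico.1 hi).1
        simp [hu.weight, show ¬ i < m by omega]
      rw [LinearMap.sum_apply, Finset.sum_congr rfl h1, ← Finset.sum_smul, ← Finset.sum_filter,
        Finset.filter_mem_eq_inter, Finset.inter_eq_right.2 hsub]
      push_cast
      rfl
  choose u huF hu0 hu using key
  have hlin : LinearIndependent ℂ u :=
    Module.End.eigenvectors_linearIndependent' (∑ i ∈ Finset.Ico m R, (2 : ℂ) ^ i • act V i i)
      (fun s : (Finset.Ico m R).powersetCard n => ((∑ i ∈ (s : Finset ℕ), 2 ^ i : ℕ) : ℂ))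
      (fun s t h => Subtype.ext (sum_two_pow_injective (Nat.cast_injective h))) u
      fun s => ⟨Module.End.mem_eigenspace_iff.2 (hu s), hu0 s⟩
  have hlin' : LinearIndependent ℂ fun s => (⟨u s, huF s⟩ : filtration (words v) j) :=
    LinearIndependent.of_comp (filtration (words v) j).subtype hlin
  have := hlin'.fintype_card_le_finrank
  simpa using this

/-- Movability of `n` units of weight forces growth of order at least `n`: with
`R = ⌊(j - d) / (n + 1)⌋`, the binomial coefficient `C(R - m, n)` is of order `j^n`. -/
theorem pow_le_finrank [LieModule.IsIrreducible ℂ gl V] {lam : ℕ →₀ ℂ} {v w : V}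
    (hv : IsHighestWeightVector lam v) {μ : ℕ → ℂ} {m n d : ℕ}
    (hw : IsBoundedWeightVector μ m w) (hd : w ∈ words v d) (hmov : Movable m n μ) :
    ∃ c : ℝ, 0 < c ∧ ∀ᶠ j : ℕ in Filter.atTop,
      c * (j : ℝ) ^ n ≤ Module.finrank ℂ (filtration (words v) j) := by
  refine ⟨((2 * (n + 1) : ℝ) ^ n * n.factorial)⁻¹, by positivity, ?_⟩
  filter_upwards [Filter.eventually_ge_atTop (2 * (d + (n + 1) * (m + n)))] with j hj
  -- Dividing by `n + 1` rather than `n` includes the case `n = 0`.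
  set R := (j - d) / (n + 1) with hR
  have h1 : (n + 1) * R ≤ j - d := Nat.mul_div_le _ _
  have h2 : j - d < (n + 1) * (R + 1) := Nat.lt_mul_div_succ _ (Nat.succ_pos n)
  have hdj : d ≤ j := by nlinarith [Nat.zero_le ((n + 1) * (m + n))]
  have h3 : d + n * R ≤ j := by
    have : n * R ≤ (n + 1) * R := Nat.mul_le_mul_right R (Nat.le_succ n)
    omega
  have h4 : (j : ℝ) ≤ 2 * (n + 1) * ((R - m + 1 - n : ℕ) : ℝ) := by
    have h5 : m + n ≤ R + 1 := by
      by_contra h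
      have : (n + 1) * (R + 1) ≤ (n + 1) * (m + n) := Nat.mul_le_mul_left _ (by omega)
      omega
    have h6 : R + 1 ≤ (R - m + 1 - n) + (m + n) := by omega
    have h7 : (n + 1) * (R + 1) ≤ (n + 1) * (R - m + 1 - n) + (n + 1) * (m + n) := by
      rw [← mul_add]
      exact Nat.mul_le_mul_left _ h6
    have h8 : j ≤ 2 * ((n + 1) * (R - m + 1 - n)) := by omega
    rw [mul_assoc]
    exact_mod_cast h8
  have h9 := Nat.pow_le_choose (α := ℝ) n (R - m)
  have h10 : ((R - m).choose n : ℝ) ≤ Module.finrank ℂ (filtration (words v) j) := by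
    exact_mod_cast choose_le_finrank hv hw hd hmov h3
  refine le_trans ?_ (h9.trans h10)
  rw [inv_mul_le_iff₀ (by positivity), mul_assoc, mul_div_cancel₀ _ (by positivity), ← mul_pow]
  exact pow_le_pow_left₀ (by positivity) h4 n

end Modules

/-! ### Growth from bounds on dimensions -/

section Growth

variable {V : Type*} [AddCommGroup V] [Module ℂ V]

open Filter Topology in
theorem tendsto_log_add_div_log (c : ℝ) (n : ℕ) :
    Tendsto (fun j : ℕ => (((Real.log c + n * Real.log j) / Real.log j : ℝ) : EReal)) atTop
      (𝓝 (n : EReal)) := by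
  have hlog : Tendsto (fun j : ℕ => Real.log j) atTop atTop :=
    Real.tendsto_log_atTop.comp tendsto_natCast_atTop_atTop
  have h : Tendsto (fun j : ℕ => Real.log c / Real.log j + n) atTop (𝓝 (0 + n)) :=
    (hlog.const_div_atTop _).add tendsto_const_nhds
  rw [zero_add] at h
  have h2 := (continuous_coe_real_ereal.tendsto (n : ℝ)).comp h
  refine Tendsto.congr' ?_ h2
  filter_upwards [eventually_gt_atTop 1] with j hj
  have : Real.log j ≠ 0 := (Real.log_pos (by exact_mod_cast hj)).ne'
  simp only [Function.comp]
  congr 1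
  field_simp

theorem le_growth {F : ℕ → Submodule ℂ V} {n : ℕ} {c : ℝ} (hc : 0 < c)
    (h : ∀ᶠ j : ℕ in Filter.atTop, c * (j : ℝ) ^ n ≤ Module.finrank ℂ (F j)) :
    (n : EReal) ≤ growth F := by
  rw [growth, ← (tendsto_log_add_div_log c n).limsup_eq]
  refine Filter.limsup_le_limsup ?_
  filter_upwards [h, Filter.eventually_gt_atTop 1] with j hj h1
  have hj0 : (0 : ℝ) < j := by exact_mod_cast (by omega : 0 < j)
  have hl : 0 < Real.log j := Real.log_pos (by exact_mod_cast h1)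
  rw [EReal.coe_le_coe_iff, ← Real.log_pow, ← Real.log_mul hc.ne' (by positivity)]
  exact div_le_div_of_nonneg_right (Real.log_le_log (by positivity) hj) hl.le

theorem growth_le {F : ℕ → Submodule ℂ V} {n : ℕ} {c : ℝ} (hc : 1 ≤ c)
    (h : ∀ᶠ j : ℕ in Filter.atTop, (Module.finrank ℂ (F j) : ℝ) ≤ c * (j : ℝ) ^ n) :
    growth F ≤ n := by
  rw [growth, ← (tendsto_log_add_div_log c n).limsup_eq]
  refine Filter.limsup_le_limsup ?_
  filter_upwards [h, Filter.eventually_gt_atTop 1] with j hj h1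
  have hj1 : (1 : ℝ) ≤ j := by exact_mod_cast h1.le
  have hl : 0 < Real.log j := Real.log_pos (by exact_mod_cast h1)
  rw [EReal.coe_le_coe_iff]
  refine div_le_div_of_nonneg_right ?_ hl.le
  rcases Nat.eq_zero_or_pos (Module.finrank ℂ (F j)) with h0 | h0
  · -- Here `Real.log 0 = 0`, and the bound is non-negative because `1 ≤ c`.
    rw [h0, Nat.cast_zero, Real.log_zero]
    have := Real.log_nonneg hc
    positivity
  · rw [← Real.log_pow, ← Real.log_mul (by positivity) (by positivity)]
    exact Real.log_le_log (by exact_mod_cast h0) hj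

end Growth

/-! ### Lower bounds for the growth -/

theorem exists_forall_ge_eq_zero (lam : ℕ →₀ ℂ) (n : ℕ) :
    ∃ m, n ≤ m ∧ ∀ i, m ≤ i → lam i = 0 := by
  obtain ⟨m, hm⟩ := lam.support.exists_nat_subset_range
  refine ⟨max n m, le_max_left _ _, fun i hi => ?_⟩
  by_contra h
  have h1 := Finset.mem_range.1 (hm (Finsupp.mem_support_iff.2 h))
  have h2 := le_max_right n m
  omega

theorem movable_of_sum_eq (m n : ℕ) :
    ∀ a : ℕ → ℕ, ∑ i ∈ Finset.range m, a i = n → Movable m n fun i => a i := by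
  induction n with
  | zero => exact fun _ _ => trivial
  | succ n ih =>
    intro a ha
    obtain ⟨i, hi, hi0⟩ := Finset.exists_ne_zero_of_sum_ne_zero (ha.trans_ne n.succ_ne_zero)
    refine ⟨i, Finset.mem_range.1 hi, Nat.cast_ne_zero.2 hi0, ?_⟩
    have h1 : ∀ j, a j = (if j = i then a j - 1 else a j) + if j = i then 1 else 0 := by
      intro j
      split_ifs with h
      · subst h
        omega
      · rfl
    have h2 := ih (fun j => if j = i then a j - 1 else a j) (by
      have h3 := ha
      rw [Finset.sum_congr rfl fun j _ => h1 j, Finset.sum_add_distrib,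
        Finset.sum_ite_eq' (Finset.range m) i, if_pos hi] at h3
      omega)
    convert h2 using 1
    funext j
    dsimp only
    split_ifs with h
    · subst h
      rw [Nat.cast_sub (Nat.one_le_iff_ne_zero.2 hi0), Nat.cast_one]
    · simp

theorem movable_of_forall_ne_natCast {m i : ℕ} (hi : i < m) (n : ℕ) :
    ∀ μ : ℕ → ℂ, (∀ k : ℕ, μ i ≠ k) → Movable m n μ := by
  induction n with
  | zero => exact fun _ _ => trivial
  | succ n ih =>
    intro μ hμ
    refine ⟨i, hi, by simpa using hμ 0, ih _ fun k h => hμ (k + 1) ?_⟩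
    rw [if_pos rfl] at h
    push_cast
    linear_combination h

theorem IsHighestWeightVector.isBounded {V : Type*} [AddCommGroup V] [Module ℂ V]
    [LieRingModule gl V] {lam : ℕ →₀ ℂ} {v : V} (hv : IsHighestWeightVector lam v) {m : ℕ}
    (hm : ∀ i, m ≤ i → lam i = 0) : IsBoundedWeightVector lam m v :=
  ⟨hv.ne_zero, hv.weight, hm, fun x a h _ => hv.raising x a h⟩

section Modules

variable {V : Type*} [AddCommGroup V] [Module ℂ V] [LieRingModule gl V] [LieModule ℂ gl V]

/-- If `λ_i - λ_{i+1}` is not a non-negative integer, the powers of `E_{i+1,i}` never kill the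
highest weight vector, because
`E_{i,i+1} E_{i+1,i}^{K+1} v = (K + 1) (λ_i - λ_{i+1} - K) E_{i+1,i}^K v`. -/
theorem isBounded_iterate {lam : ℕ →₀ ℂ} {v : V} (hv : IsHighestWeightVector lam v) {i m : ℕ}
    (hm : ∀ j, m ≤ j → lam j = 0) (him : i + 2 ≤ m) (hi : ∀ K : ℕ, lam i - lam (i + 1) ≠ K)
    (K : ℕ) :
    IsBoundedWeightVector
      (fun j => lam j + (if j = i + 1 then (K : ℂ) else 0) - (if j = i then (K : ℂ) else 0)) m
      ((fun x : V => ⁅E (i + 1) i, x⁆)^[K] v) ∧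
    (fun x : V => ⁅E (i + 1) i, x⁆)^[K] v ∈ words v K ∧
    ⁅E i (i + 1), (fun x : V => ⁅E (i + 1) i, x⁆)^[K + 1] v⁆ =
      (((K : ℂ) + 1) * (lam i - lam (i + 1) - K)) • (fun x : V => ⁅E (i + 1) i, x⁆)^[K] v := by
  induction K with
  | zero =>
    refine ⟨by simpa using hv.isBounded hm, mem_words_zero v, ?_⟩
    simp only [zero_add, Function.iterate_one, Function.iterate_zero, id]
    rw [lie_E_lie_E, hv.raising i (i + 1) (by omega), if_pos rfl, if_pos rfl, hv.weight,
      hv.weight]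
    simp [sub_smul]
  | succ K ih =>
    obtain ⟨hb, hw, he⟩ := ih
    rw [Function.iterate_succ_apply' _ (K + 1)]
    have hb' : IsBoundedWeightVector
        (fun j => lam j + (if j = i + 1 then ((K + 1 : ℕ) : ℂ) else 0) -
          (if j = i then ((K + 1 : ℕ) : ℂ) else 0)) m
        ((fun x : V => ⁅E (i + 1) i, x⁆)^[K + 1] v) := by
      refine ⟨fun h => ?_, fun j => ?_, fun j hj => ?_, fun x a hxa ha => ?_⟩
      · rw [h, lie_zero] at he
        refine smul_ne_zero (mul_ne_zero (Nat.cast_add_one_ne_zero K) ?_) hb.ne_zero he.symm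
        exact fun h0 => hi K (sub_eq_zero.1 h0)
      · rw [Function.iterate_succ_apply', lie_weight hb.weight]
        congr 1
        push_cast
        split_ifs <;> ring
      · have := hm j hj
        simp [this, show j ≠ i by omega, show j ≠ i + 1 by omega]
      · rw [Function.iterate_succ_apply', lie_E_lie_E, hb.raising x a hxa ha, lie_zero,
          if_neg (by omega : a ≠ i + 1), hb.raising (i + 1) a (by omega) ha]
        simp
    refine ⟨hb', ?_, ?_⟩
    · rw [Function.iterate_succ_apply']
      exact lie_mem_words_succ hw i
    · rw [lie_E_lie_E, he, if_pos rfl, if_pos rfl, hb'.weight, hb'.weight, lie_smul,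
        ← Function.iterate_succ_apply' (fun x : V => ⁅E (i + 1) i, x⁆) K v, ← sub_smul,
        ← add_smul]
      congr 1
      simp
      ring

theorem natCast_le_growth_of_sum_eq [LieModule.IsIrreducible ℂ gl V] {lam : ℕ →₀ ℂ} {v : V}
    (hv : IsHighestWeightVector lam v) {m n : ℕ} (hm : ∀ i, m ≤ i → lam i = 0) {a : ℕ → ℕ}
    (ha : ∀ i, lam i = a i) (hn : ∑ i ∈ Finset.range m, a i = n) :
    (n : EReal) ≤ growth (filtration (words v)) := by
  have hmov : Movable m n lam := by
    rw [show (lam : ℕ → ℂ) = fun i => (a i : ℂ) from funext ha]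
    exact movable_of_sum_eq m n a hn
  obtain ⟨c, hc, h⟩ := pow_le_finrank hv (hv.isBounded hm) (mem_words_zero v) hmov
  exact le_growth hc h

theorem mem_Par_of_le_natCast {lam : ℕ →₀ ℂ} {a : ℕ → ℕ} (ha : ∀ i, lam i = a i)
    (h : ∀ i, a (i + 1) ≤ a i) : lam ∈ Par :=
  ⟨fun i => a i, antitone_nat_of_succ_le fun i => by exact_mod_cast h i, fun i => by
    rw [ha i]
    push_cast
    rfl⟩

/-- If some coordinate of a bounded weight vector is not a natural number, then it can be lowered
indefinitely, and the growth is infinite. -/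
theorem growth_eq_top_of_bounded [LieModule.IsIrreducible ℂ gl V] {lam : ℕ →₀ ℂ} {v w : V}
    (hv : IsHighestWeightVector lam v) {μ : ℕ → ℂ} {m d i : ℕ}
    (hw : IsBoundedWeightVector μ m w) (hd : w ∈ words v d) (him : i < m)
    (hi : ∀ k : ℕ, μ i ≠ k) : growth (filtration (words v)) = ⊤ := by
  have h (n : ℕ) : (n : EReal) ≤ growth (filtration (words v)) := by
    obtain ⟨c, hc, h⟩ := pow_le_finrank hv hw hd (movable_of_forall_ne_natCast him n μ hi)
    exact le_growth hc h
  rw [EReal.eq_top_iff_forall_lt]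
  intro y
  obtain ⟨n, hn⟩ := exists_nat_gt y
  exact lt_of_lt_of_le (by exact_mod_cast hn) (h n)

/-- Outside `Par⁺`, either some `λ_i` is not a natural number, or `λ_i < λ_{i+1}` for some `i` and
then `E_{i+1,i}^K v` has a negative `i`-th coordinate of its weight when `K = λ_i + 1`. -/
theorem growth_eq_top [LieModule.IsIrreducible ℂ gl V] {lam : ℕ →₀ ℂ} {v : V}
    (hv : IsHighestWeightVector lam v) (hlam : lam ∉ Par) :
    growth (filtration (words v)) = ⊤ := by
  by_cases h : ∀ i, ∃ k : ℕ, lam i = k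
  · choose a ha using h
    obtain ⟨i, hi⟩ : ∃ i, a i < a (i + 1) := by
      by_contra! hcon
      exact hlam (mem_Par_of_le_natCast ha hcon)
    obtain ⟨m, him, hm⟩ := exists_forall_ge_eq_zero lam (i + 2)
    have hne : ∀ K : ℕ, lam i - lam (i + 1) ≠ K := by
      intro K hK
      rw [ha, ha, sub_eq_iff_eq_add] at hK
      have : a i = K + a (i + 1) := by exact_mod_cast hK
      omega
    obtain ⟨hb, hw, -⟩ := isBounded_iterate hv hm him hne (a i + 1)
    refine growth_eq_top_of_bounded hv hb hw (by omega : i < m) fun k hk => ?_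
    simp only [Nat.left_eq_add, one_ne_zero, if_false, if_true, ha i] at hk
    have : ((k + 1 : ℕ) : ℂ) = 0 := by
      push_cast at hk ⊢
      linear_combination -hk
    exact Nat.succ_ne_zero k (Nat.cast_eq_zero.1 this)
  · push Not at h
    obtain ⟨i, hi⟩ := h
    obtain ⟨m, him, hm⟩ := exists_forall_ge_eq_zero lam (i + 1)
    exact growth_eq_top_of_bounded hv (hv.isBounded hm) (mem_words_zero v) him hi

end Modules

/-! ### Derivations of rings and of their fraction fields -/

theorem derivation_ext_of_fraction (A : Type*) [CommRing A] {K : Type*} [Field K] [Algebra A K]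
    [IsFractionRing A K] [Algebra ℂ K] {D₁ D₂ : Derivation ℂ K K}
    (h : ∀ a, D₁ (algebraMap A K a) = D₂ (algebraMap A K a)) : D₁ = D₂ := by
  ext x
  obtain ⟨a, b, -, rfl⟩ := IsFractionRing.div_surjective (A := A) x
  rw [D₁.leibniz_div, D₂.leibniz_div, h, h]

section Derivations

variable {A : Type*} [CommRing A] [Algebra ℂ A]

theorem derivation_prod (D : Derivation ℂ A A) {ι : Type*} [DecidableEq ι] (s : Finset ι)
    (f : ι → A) : D (∏ i ∈ s, f i) = ∑ i ∈ s, (∏ j ∈ s.erase i, f j) * D (f i) := by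
  induction s using Finset.induction_on with
  | empty => simp
  | insert a s ha ih =>
    have h : ∀ i ∈ s, (∏ j ∈ (insert a s).erase i, f j) * D (f i) =
        f a * ((∏ j ∈ s.erase i, f j) * D (f i)) := by
      intro i hi
      have hia : i ≠ a := fun h => ha (h ▸ hi)
      rw [Finset.erase_insert_of_ne hia.symm, Finset.prod_insert (by simp [ha]), mul_assoc]
    rw [Finset.prod_insert ha, Finset.sum_insert ha, D.leibniz, ih, Finset.erase_insert ha,
      smul_eq_mul, smul_eq_mul, Finset.mul_sum, Finset.sum_congr rfl h, add_comm]

theorem derivation_det (D : Derivation ℂ A A) {n : Type*} [Fintype n] [DecidableEq n]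
    (M : Matrix n n A) : D M.det = ∑ i, (M.updateCol i fun a => D (M a i)).det := by
  simp only [Matrix.det_apply, map_sum, map_zsmul_unit]
  rw [Finset.sum_comm]
  refine Finset.sum_congr rfl fun σ _ => ?_
  rw [← Finset.smul_sum, derivation_prod]
  congr 1
  refine Finset.sum_congr rfl fun i _ => ?_
  rw [← Finset.prod_erase_mul _ _ (Finset.mem_univ i), Matrix.updateCol_self]
  congr 1
  refine Finset.prod_congr rfl fun j hj => ?_
  rw [Matrix.updateCol_ne (Finset.ne_of_mem_erase hj)]

/-- Eigenvectors of a derivation are closed under products, and eigenvalues add up. -/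
theorem derivation_prod_pow_eq_smul (D : Derivation ℂ A A) {ι : Type*} (s : Finset ι) (f : ι → A)
    (n : ι → ℕ) (α : ι → ℂ) (h : ∀ i ∈ s, D (f i) = α i • f i) :
    D (∏ i ∈ s, f i ^ n i) = (∑ i ∈ s, n i * α i) • ∏ i ∈ s, f i ^ n i := by
  classical
  induction s using Finset.induction_on with
  | empty => simp
  | insert a s ha ih =>
    have hpow : ∀ k : ℕ, D (f a ^ k) = (k * α a) • f a ^ k := by
      intro k
      induction k with
      | zero => simp
      | succ k ih =>
        rw [pow_succ, D.leibniz, ih, h a (Finset.mem_insert_self a s), smul_eq_mul, smul_eq_mul,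
          mul_smul_comm, mul_smul_comm, mul_comm (f a), ← add_smul]
        congr 1
        push_cast
        ring
    rw [Finset.prod_insert ha, Finset.sum_insert ha, D.leibniz, hpow,
      ih fun i hi => h i (Finset.mem_insert_of_mem hi), smul_eq_mul, smul_eq_mul, mul_smul_comm,
      mul_smul_comm, mul_comm (∏ i ∈ s, f i ^ n i), ← add_smul, add_comm]

variable {K : Type*} [Field K] [Algebra A K] [IsFractionRing A K] [Algebra ℂ K]
  [IsScalarTower ℂ A K]

/-- A derivation of a domain extends to its field of fractions, because localizations are formally
étale. -/
theorem exists_derivation_extension (D : Derivation ℂ A A) :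
    ∃ D' : Derivation ℂ K K, ∀ a, D' (algebraMap A K a) = algebraMap A K (D a) := by
  have : Algebra.FormallyEtale A K := Algebra.FormallyEtale.of_isLocalization (nonZeroDivisors A)
  refine ⟨((((Algebra.linearMap A K).compDer D).liftKaehlerDifferential.liftBaseChange K) ∘ₗ
    (KaehlerDifferential.tensorKaehlerEquivOfFormallyEtale ℂ A K).symm.toLinearMap).compDer
      (KaehlerDifferential.D ℂ K), fun a => ?_⟩
  simp [KaehlerDifferential.tensorKaehlerEquivOfFormallyEtale_symm_D_algebraMap]

variable (K) in
/-- The extension of derivations to the field of fractions, as a homomorphism of Lie algebras. -/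
def extendDerivation : Derivation ℂ A A →ₗ⁅ℂ⁆ Derivation ℂ K K where
  toFun D := (exists_derivation_extension D).choose
  map_add' D₁ D₂ := derivation_ext_of_fraction A fun a => by
    have h := fun D : Derivation ℂ A A => (exists_derivation_extension (K := K) D).choose_spec
    rw [Derivation.add_apply, h, h, h, Derivation.add_apply, map_add]
  map_smul' c D := derivation_ext_of_fraction A fun a => by
    have h := fun D : Derivation ℂ A A => (exists_derivation_extension (K := K) D).choose_spec
    rw [RingHom.id_apply, Derivation.smul_apply, h, h, Derivation.smul_apply]
    exact map_smul (IsScalarTower.toAlgHom ℂ A K) c (D a)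
  map_lie' {D₁ D₂} := derivation_ext_of_fraction A fun a => by
    have h := fun D : Derivation ℂ A A => (exists_derivation_extension (K := K) D).choose_spec
    rw [Derivation.commutator_apply, h, h, h, h, h, Derivation.commutator_apply, map_sub]

theorem extendDerivation_algebraMap (D : Derivation ℂ A A) (a : A) :
    extendDerivation K D (algebraMap A K a) = algebraMap A K (D a) :=
  (exists_derivation_extension (K := K) D).choose_spec a

end Derivations

/-! ### Twisting by logarithmic derivatives -/

section Twist

variable {L : Type*} [LieRing L] [LieAlgebra ℂ L] {K : Type*} [Field K] [Algebra ℂ K]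
  (ρ : L →ₗ⁅ℂ⁆ Derivation ℂ K K) {ι : Type*} (s : Finset ι) (g : ι → K) (c : ι → ℂ)

/-- The logarithmic derivative of the formal expression `∏ g_k ^ c_k` with complex exponents. -/
def logDerivProd (D : Derivation ℂ K K) : K := ∑ k ∈ s, c k • (D (g k) / g k)

theorem logDerivProd_add (D₁ D₂ : Derivation ℂ K K) :
    logDerivProd s g c (D₁ + D₂) = logDerivProd s g c D₁ + logDerivProd s g c D₂ := by
  simp [logDerivProd, add_div, Finset.sum_add_distrib]

theorem logDerivProd_smul (a : ℂ) (D : Derivation ℂ K K) :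
    logDerivProd s g c (a • D) = a • logDerivProd s g c D := by
  simp only [logDerivProd, Finset.smul_sum, Derivation.smul_apply, smul_div_assoc]
  exact Finset.sum_congr rfl fun k _ => smul_comm _ _ _

/-- The logarithmic derivative is a cocycle, so that it may be added to the action. -/
theorem logDerivProd_lie (D₁ D₂ : Derivation ℂ K K) :
    logDerivProd s g c ⁅D₁, D₂⁆ = D₁ (logDerivProd s g c D₂) - D₂ (logDerivProd s g c D₁) := by
  simp only [logDerivProd, map_sum, Derivation.map_smul, ← Finset.sum_sub_distrib, ← smul_sub]
  refine Finset.sum_congr rfl fun k _ => ?_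
  congr 1
  rw [Derivation.commutator_apply, Derivation.leibniz_div, Derivation.leibniz_div]
  by_cases h : g k = 0
  · simp [h]
  · simp only [smul_eq_mul]
    field_simp
    ring

/-- The action of a Lie algebra of derivations on the formal products `f ∏ g_k ^ c_k`, in
terms of `f ∈ K`. -/
abbrev twistedLieRingModule : LieRingModule L K where
  bracket x f := ρ x f + logDerivProd s g c (ρ x) * f
  add_lie x y f := by
    simp only [map_add, logDerivProd_add, Derivation.add_apply]
    ring
  lie_add x f h := by
    simp only [map_add]
    ring
  leibniz_lie x y f := by
    simp only [LieHom.map_lie, logDerivProd_lie, map_add, Derivation.leibniz, smul_eq_mul,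
      Derivation.commutator_apply]
    ring

theorem twistedLieModule :
    letI := twistedLieRingModule ρ s g c
    LieModule ℂ L K :=
  letI := twistedLieRingModule ρ s g c
  { smul_lie := fun a x f => by
      change ρ (a • x) f + logDerivProd s g c (ρ (a • x)) * f = a • (_ + _)
      rw [map_smul, logDerivProd_smul, Derivation.smul_apply, smul_mul_assoc, smul_add]
    lie_smul := fun a x f => by
      change ρ x (a • f) + _ * (a • f) = a • (_ + _)
      rw [Derivation.map_smul, mul_smul_comm, smul_add] }

end Twist

/-! ### Polynomials in the entries of a generic matrix -/

open MvPolynomial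

/-- Polynomials in the entries `x_{ia}` of an infinite matrix. -/
abbrev MatPoly : Type := MvPolynomial (ℕ × ℕ) ℂ

/-- The `a`-th column of the generic matrix, as a linear map on row vectors:
`e_i ↦ x_{ia}`. -/
def genericCol (a : ℕ) : (ℕ →₀ ℂ) →ₗ[ℂ] MatPoly :=
  Finsupp.linearCombination ℂ fun i => X (i, a)

/-- The action of `gl_{+∞}` on polynomials by the vector fields induced from its action on the
columns, so that `E_{ij}` acts by `∑_a x_{ia} ∂/∂x_{ja}`. -/
def polyAction : gl →ₗ⁅ℂ⁆ Derivation ℂ MatPoly MatPoly where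
  toFun A := mkDerivation ℂ fun p => genericCol p.2 (A.1 (Finsupp.single p.1 1))
  map_add' A B := derivation_ext fun p => by
    simp [mkDerivation_X]
  map_smul' c A := derivation_ext fun p => by
    simp [mkDerivation_X]
  map_lie' {A B} := derivation_ext fun p => by
    have h (A : gl) (a : ℕ) (u : ℕ →₀ ℂ) :
        mkDerivation ℂ (fun p : ℕ × ℕ => genericCol p.2 (A.1 (Finsupp.single p.1 1)))
          (genericCol a u) = genericCol a (A.1 u) := by
      induction u using Finsupp.induction_linear with
      | zero => simp
      | add u w hu hw => simp [hu, hw]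
      | single i c =>
        have e : Finsupp.single i c = c • Finsupp.single i (1 : ℂ) := by simp
        rw [e, map_smul (genericCol a), Derivation.map_smul, map_smul A.1, map_smul (genericCol a)]
        congr 1
        simp [genericCol, mkDerivation_X]
    have e : ((⁅A, B⁆ : gl) : Module.End ℂ (ℕ →₀ ℂ)) = A.1 * B.1 - B.1 * A.1 := rfl
    rw [Derivation.commutator_apply, mkDerivation_X, mkDerivation_X, mkDerivation_X, h, h, e]
    simp

theorem polyAction_E_X (i j b a : ℕ) :
    polyAction (E i j) (X (b, a)) = if b = j then X (i, a) else 0 := by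
  have h : polyAction (E i j) (X (b, a)) =
      genericCol a ((E i j).1 (Finsupp.single b 1)) := mkDerivation_X _ _ _
  rw [h]
  have h2 : (E i j).1 (Finsupp.single b 1) = if b = j then Finsupp.single i 1 else 0 := by
    change unitEnd i j _ = _
    simp only [unitEnd, LinearMap.comp_apply, Finsupp.lapply_apply, Finsupp.lsingle_apply,
      Finsupp.single_apply]
    split_ifs <;> simp
  rw [h2]
  split_ifs <;> simp [genericCol]

/-- The transpose of the upper left `k × k` block of the generic matrix, so that the row index of
`gl_{+∞}` numbers the columns. -/
def genericBlock (k : ℕ) : Matrix (Fin k) (Fin k) MatPoly :=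
  Matrix.of fun a b => X ((b : ℕ), (a : ℕ))

/-- The leading principal minor of size `k` of the generic matrix. -/
def leadingMinor (k : ℕ) : MatPoly := (genericBlock k).det

theorem leadingMinor_ne_zero (k : ℕ) : leadingMinor k ≠ 0 := by
  intro h
  have h1 := congrArg (MvPolynomial.eval fun p : ℕ × ℕ => if p.1 = p.2 then (1 : ℂ) else 0) h
  rw [leadingMinor, RingHom.map_det, map_zero] at h1
  have h2 : (MvPolynomial.eval fun p : ℕ × ℕ => if p.1 = p.2 then (1 : ℂ) else 0).mapMatrix
      (genericBlock k) = 1 := by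
    ext a b
    simp [genericBlock, Matrix.one_apply, Fin.ext_iff, eq_comm]
  rw [h2, Matrix.det_one] at h1
  exact one_ne_zero h1

theorem polyAction_raising_leadingMinor {i j : ℕ} (h : i < j) (k : ℕ) :
    polyAction (E i j) (leadingMinor k) = 0 := by
  rw [leadingMinor, derivation_det]
  refine Finset.sum_eq_zero fun b _ => ?_
  -- Only the column `j` is changed, and it becomes a copy of the column `i < j`.
  by_cases hb : (b : ℕ) = j
  · have hib : (⟨i, by omega⟩ : Fin k) ≠ b := fun h' => by
      rw [← h'] at hb
      exact h.ne hb
    refine Matrix.det_zero_of_column_eq hib fun a => ?_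
    rw [Matrix.updateCol_self, Matrix.updateCol_ne hib]
    simp [genericBlock, polyAction_E_X, hb]
  · refine Matrix.det_eq_zero_of_column_eq_zero b fun a => ?_
    simp [genericBlock, polyAction_E_X, hb]

theorem polyAction_diag_leadingMinor (i k : ℕ) :
    polyAction (E i i) (leadingMinor k) = (if i < k then (1 : ℂ) else 0) • leadingMinor k := by
  rw [leadingMinor, derivation_det]
  have h0 (b : Fin k) (hb : (b : ℕ) ≠ i) : ((genericBlock k).updateCol b fun a =>
      polyAction (E i i) (genericBlock k a b)).det = 0 := by
    refine Matrix.det_eq_zero_of_column_eq_zero b fun a => ?_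
    simp [genericBlock, polyAction_E_X, hb]
  split_ifs with hik
  · rw [Finset.sum_eq_single (⟨i, hik⟩ : Fin k) (fun b _ hb => h0 b fun h => hb (Fin.ext h))
      (by simp), one_smul]
    congr 1
    ext1 a b
    by_cases hb : b = ⟨i, hik⟩
    · subst hb
      rw [Matrix.updateCol_self]
      simp [genericBlock, polyAction_E_X]
    · rw [Matrix.updateCol_ne hb]
  · rw [zero_smul]
    exact Finset.sum_eq_zero fun b _ => h0 b (by omega)

/-- Summation by parts for the exponents `c_k = λ_k - λ_{k+1}` of the leading minors. -/
theorem sum_sub_succ (f : ℕ → ℂ) (i N : ℕ) :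
    ∑ k ∈ Finset.range N, (f k - f (k + 1)) * (if i < k + 1 then (1 : ℂ) else 0) =
      if i < N then f i - f N else 0 := by
  induction N with
  | zero => simp
  | succ N ih =>
    rw [Finset.sum_range_succ, ih]
    rcases lt_trichotomy i N with h | rfl | h
    · simp [h, h.trans (Nat.lt_succ_self N)]
    · simp
    · simp [show ¬ i < N by omega, show ¬ i ≤ N by omega]

theorem sum_sub_succ_eq {lam : ℕ →₀ ℂ} {N : ℕ} (hN : ∀ i, N ≤ i → lam i = 0) (i : ℕ) :
    ∑ k ∈ Finset.range N, (lam k - lam (k + 1)) * (if i < k + 1 then (1 : ℂ) else 0) = lam i := by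
  rw [sum_sub_succ, hN N le_rfl, sub_zero]
  split_ifs with h
  · rfl
  · exact (hN i (by omega)).symm

/-- The polynomial representation of `gl_{+∞}`. -/
abbrev polyLieRingModule : LieRingModule gl MatPoly :=
  LieRingModule.compLieHom MatPoly polyAction

theorem polyLieModule :
    letI := polyLieRingModule
    LieModule ℂ gl MatPoly :=
  LieModule.compLieHom MatPoly polyAction

/-- For `λ ∈ Par⁺` the product of the leading minors of size `k + 1` to the powers
`λ_k - λ_{k+1}` is a highest weight vector of weight `λ` among the polynomials. -/
theorem isHighestWeightVector_prod_leadingMinor {lam : ℕ →₀ ℂ} {N : ℕ} {n : ℕ → ℕ}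
    (hN : ∀ i, N ≤ i → lam i = 0) (hn : ∀ k, (n k : ℂ) = lam k - lam (k + 1)) :
    letI := polyLieRingModule
    IsHighestWeightVector lam (∏ k ∈ Finset.range N, leadingMinor (k + 1) ^ n k) := by
  let := polyLieRingModule
  refine ⟨Finset.prod_ne_zero_iff.2 fun k _ => pow_ne_zero _ (leadingMinor_ne_zero _),
    fun i j hij => ?_, fun i => ?_⟩
  · change polyAction (E i j) _ = 0
    rw [derivation_prod_pow_eq_smul _ _ _ _ (fun _ => 0) fun k _ => by
      rw [polyAction_raising_leadingMinor hij, zero_smul]]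
    simp
  · change polyAction (E i i) _ = _
    rw [derivation_prod_pow_eq_smul _ _ _ _ (fun k => if i < k + 1 then (1 : ℂ) else 0) fun k _ =>
      polyAction_diag_leadingMinor i (k + 1)]
    simp only [hn]
    rw [sum_sub_succ_eq hN]

/-- For arbitrary `λ` the formal product of the leading minors of size `k + 1` to the complex powers
`λ_k - λ_{k+1}` is a highest weight vector of weight `λ`. -/
theorem exists_highestWeightVector (lam : ℕ →₀ ℂ) :
    ∃ (V : Type) (_ : AddCommGroup V) (_ : Module ℂ V) (_ : LieRingModule gl V)
      (_ : LieModule ℂ gl V) (v : V), IsHighestWeightVector lam v := by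
  obtain ⟨N, -, hN⟩ := exists_forall_ge_eq_zero lam 0
  let K := FractionRing MatPoly
  let ρ : gl →ₗ⁅ℂ⁆ Derivation ℂ K K := (extendDerivation K).comp polyAction
  let g : ℕ → K := fun k => algebraMap MatPoly K (leadingMinor (k + 1))
  have hg : ∀ k, g k ≠ 0 := fun k =>
    (map_ne_zero_iff _ (IsFractionRing.injective MatPoly K)).2 (leadingMinor_ne_zero _)
  let c : ℕ → ℂ := fun k => lam k - lam (k + 1)
  let := twistedLieRingModule ρ (Finset.range N) g c
  refine ⟨K, inferInstance, inferInstance, this, twistedLieModule ρ (Finset.range N) g c, 1,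
    one_ne_zero, fun i j hij => ?_, fun i => ?_⟩
  · change ρ (E i j) 1 + logDerivProd (Finset.range N) g c (ρ (E i j)) * 1 = 0
    rw [Derivation.map_one_eq_zero, zero_add, mul_one]
    refine Finset.sum_eq_zero fun k _ => ?_
    have : ρ (E i j) (g k) = 0 := by
      change extendDerivation K (polyAction (E i j)) (algebraMap MatPoly K _) = 0
      rw [extendDerivation_algebraMap, polyAction_raising_leadingMinor hij, map_zero]
    rw [this, zero_div, smul_zero]
  · change ρ (E i i) 1 + logDerivProd (Finset.range N) g c (ρ (E i i)) * 1 = lam i • 1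
    rw [Derivation.map_one_eq_zero, zero_add, mul_one, ← sum_sub_succ_eq hN i, Finset.sum_smul]
    refine Finset.sum_congr rfl fun k _ => ?_
    have : ρ (E i i) (g k) = (if i < k + 1 then (1 : ℂ) else 0) • g k := by
      change extendDerivation K (polyAction (E i i)) (algebraMap MatPoly K _) = _
      rw [extendDerivation_algebraMap, polyAction_diag_leadingMinor]
      exact map_smul (IsScalarTower.toAlgHom ℂ MatPoly K) _ _
    rw [this, smul_div_assoc, div_self (hg k), smul_smul]

/-! ### Irreducible quotients -/

/-- A highest weight vector generates a submodule, whose quotient by a maximal proper submodule is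
irreducible with a highest weight vector of the same weight. -/
theorem exists_irreducible {lam : ℕ →₀ ℂ} {V : Type} [AddCommGroup V] [Module ℂ V]
    [LieRingModule gl V] [LieModule ℂ gl V] {v : V} (hv : IsHighestWeightVector lam v) :
    ∃ (V : Type) (_ : AddCommGroup V) (_ : Module ℂ V) (_ : LieRingModule gl V)
      (_ : LieModule ℂ gl V) (v : V),
      LieModule.IsIrreducible ℂ gl V ∧ IsHighestWeightVector lam v := by
  let S := LieSubmodule.lieSpan ℂ gl {v}
  have hvS : v ∈ S := LieSubmodule.subset_lieSpan rfl
  have hgen : LieSubmodule.lieSpan ℂ gl {(⟨v, hvS⟩ : S)} = ⊤ := by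
    rw [eq_top_iff]
    rintro ⟨x, hx⟩ -
    induction hx using LieSubmodule.lieSpan_induction with
    | mem x hx =>
      obtain rfl : x = v := hx
      exact LieSubmodule.subset_lieSpan rfl
    | zero => exact zero_mem _
    | add x y hx hy h1 h2 => exact add_mem h1 h2
    | smul a x hx h => exact SMulMemClass.smul_mem a h
    | lie A x hx h => exact LieSubmodule.lie_mem _ (x := A) h
  have hcompact : IsCompactElement (⊤ : LieSubmodule ℂ gl S) := by
    rw [← hgen]
    exact LieSubmodule.isCompactElement_lieSpan_singleton ℂ gl _
  have hco := CompleteLattice.coatomic_of_top_compact hcompact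
  have hne : (⊥ : LieSubmodule ℂ gl S) ≠ ⊤ := by
    intro h
    have h1 : (⟨v, hvS⟩ : S) ∈ (⊥ : LieSubmodule ℂ gl S) := h ▸ LieSubmodule.mem_top _
    exact hv.ne_zero (congrArg Subtype.val ((LieSubmodule.mem_bot _).1 h1))
  obtain ⟨N, hN, -⟩ := (eq_top_or_exists_le_coatom (⊥ : LieSubmodule ℂ gl S)).resolve_left hne
  have hvN : (⟨v, hvS⟩ : S) ∉ N := by
    intro h
    refine hN.1 (eq_top_iff.2 (hgen ▸ LieSubmodule.lieSpan_le.2 ?_))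
    rintro _ rfl
    exact h
  have hv0 : (LieSubmodule.Quotient.mk ⟨v, hvS⟩ : S ⧸ N) ≠ 0 := fun h =>
    hvN (LieSubmodule.Quotient.mk_eq_zero'.1 h)
  have : Nontrivial (S ⧸ N) := ⟨_, _, hv0⟩
  refine ⟨S ⧸ N, inferInstance, inferInstance, inferInstance, inferInstance,
    LieSubmodule.Quotient.mk ⟨v, hvS⟩, LieModule.IsIrreducible.mk fun U hU => ?_, hv0,
    fun i j hij => ?_, fun i => ?_⟩
  · have hlt : N < U.comap (LieSubmodule.Quotient.mk' N) := by
      refine lt_of_le_of_ne (fun x hx => ?_) fun h => hU ?_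
      · rw [LieSubmodule.mem_comap, LieSubmodule.Quotient.mk'_apply,
          LieSubmodule.Quotient.mk_eq_zero'.2 hx]
        exact zero_mem _
      · rw [eq_bot_iff]
        intro y hy
        obtain ⟨x, rfl⟩ := LieSubmodule.Quotient.surjective_mk' N y
        have hx : x ∈ N := by
          rw [h]
          exact hy
        exact (LieSubmodule.mem_bot _).2 (LieSubmodule.Quotient.mk_eq_zero'.2 hx)
    have htop := hN.2 _ hlt
    rw [eq_top_iff]
    intro y _
    obtain ⟨x, rfl⟩ := LieSubmodule.Quotient.surjective_mk' N y
    have hx : x ∈ U.comap (LieSubmodule.Quotient.mk' N) := htop ▸ LieSubmodule.mem_top x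
    exact hx
  · change LieSubmodule.Quotient.mk ⁅E i j, (⟨v, hvS⟩ : S)⁆ = 0
    rw [LieSubmodule.Quotient.mk_eq_zero',
      show ⁅E i j, (⟨v, hvS⟩ : S)⁆ = 0 from Subtype.ext (hv.raising i j hij)]
    exact zero_mem _
  · change LieSubmodule.Quotient.mk ⁅E i i, (⟨v, hvS⟩ : S)⁆ = _
    rw [show ⁅E i i, (⟨v, hvS⟩ : S)⁆ = lam i • ⟨v, hvS⟩ from Subtype.ext (hv.weight i)]
    rfl


/-! ### Comparison of modules with the same highest weight -/

section Comparison

variable {V W : Type*} [AddCommGroup V] [Module ℂ V] [LieRingModule gl V] [LieModule ℂ gl V]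
  [AddCommGroup W] [Module ℂ W] [LieRingModule gl W] [LieModule ℂ gl W]

theorem map_words (f : V →ₗ⁅ℂ, gl⁆ W) (v : V) (k : ℕ) :
    (words v k).map (f : V →ₗ[ℂ] W) = words (f v) k := by
  induction k with
  | zero => simp [words, Submodule.map_span]
  | succ k ih =>
    simp only [words, Submodule.map_iSup, ← ih, ← Submodule.map_comp]
    congr 1
    funext i
    congr 1
    ext x
    exact f.map_lie _ _

theorem map_filtration_words (f : V →ₗ⁅ℂ, gl⁆ W) (v : V) (j : ℕ) :
    (filtration (words v) j).map (f : V →ₗ[ℂ] W) = filtration (words (f v)) j := by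
  simp only [filtration, Submodule.map_iSup, map_words]

theorem map_mem_degSpace (f : V →ₗ⁅ℂ, gl⁆ W) {c : ℂ} {x : V} (hx : x ∈ degSpace V c) :
    f x ∈ degSpace W c := by
  rw [mem_degSpace] at hx ⊢
  filter_upwards [hx] with N h
  have e : degOp W N (f x) = f (degOp V N x) := by
    rw [degOp_apply, degOp_apply, map_sum]
    simp
  rw [e, h]
  exact (f : V →ₗ[ℂ] W).map_smul c x

/-- The componentwise action on a product of modules. -/
abbrev prodLieRingModule (V W : Type*) [AddCommGroup V] [LieRingModule gl V] [AddCommGroup W]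
    [LieRingModule gl W] : LieRingModule gl (V × W) where
  bracket A x := (⁅A, x.1⁆, ⁅A, x.2⁆)
  add_lie A B x := Prod.ext (add_lie A B x.1) (add_lie A B x.2)
  lie_add A x y := Prod.ext (lie_add A x.1 y.1) (lie_add A x.2 y.2)
  leibniz_lie A B x := Prod.ext (leibniz_lie A B x.1) (leibniz_lie A B x.2)

attribute [local instance] prodLieRingModule

theorem prodLieModule : LieModule ℂ gl (V × W) where
  smul_lie c A x := Prod.ext (smul_lie c A x.1) (smul_lie c A x.2)
  lie_smul c A x := Prod.ext (lie_smul c A x.1) (lie_smul c A x.2)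

attribute [local instance] prodLieModule

/-- The irreducible module is a quotient of the submodule generated by any highest weight vector
`t` of the same weight.  The submodule of `V × W` generated by `(v, t)` maps onto `V`, and it maps
injectively to `W`: the kernel is a submodule of `V` that does not contain `v`, because the degree
zero part of the generated submodule is spanned by `(v, t)`. -/
theorem finrank_filtration_le [LieModule.IsIrreducible ℂ gl V] {lam : ℕ →₀ ℂ} {v : V} {t : W}
    (hv : IsHighestWeightVector lam v) (ht : IsHighestWeightVector lam t) (j : ℕ)
    [FiniteDimensional ℂ (filtration (words t) j)] :
    Module.finrank ℂ (filtration (words v) j) ≤ Module.finrank ℂ (filtration (words t) j) := by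
  let fst : V × W →ₗ⁅ℂ, gl⁆ V := { LinearMap.fst ℂ V W with map_lie' := rfl }
  let snd : V × W →ₗ⁅ℂ, gl⁆ W := { LinearMap.snd ℂ V W with map_lie' := rfl }
  let inl : V →ₗ⁅ℂ, gl⁆ V × W :=
    { LinearMap.inl ℂ V W with map_lie' := Prod.ext rfl (lie_zero _).symm }
  have hz : IsHighestWeightVector lam (v, t) :=
    ⟨fun h => hv.ne_zero (congrArg Prod.fst h),
      fun a b hab => Prod.ext (hv.raising a b hab) (ht.raising a b hab),
      fun a => Prod.ext (hv.weight a) (ht.weight a)⟩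
  have hinj : ∀ x : V, (x, (0 : W)) ∈ ⨆ k, words (v, t) k → x = 0 := by
    intro x hx
    by_contra hx0
    have htop : (⨆ k, words (v, t) k).comap (LinearMap.inl ℂ V W) = ⊤ := by
      refine eq_top_of_stable _ (fun a b y hy => ?_) hx hx0
      have := lie_mem_iSup_words hz a b _ hy
      rwa [show ⁅E a b, LinearMap.inl ℂ V W y⁆ = LinearMap.inl ℂ V W ⁅E a b, y⁆ from
        (inl.map_lie (E a b) y).symm] at this
    have hv0 : (v, (0 : W)) ∈ ⨆ k, words (v, t) k := by
      have : v ∈ (⨆ k, words (v, t) k).comap (LinearMap.inl ℂ V W) := htop ▸ Submodule.mem_top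
      exact this
    have hdeg : (v, (0 : W)) ∈ degSpace (V × W) (topDeg lam + (0 : ℕ)) := by
      rw [Nat.cast_zero, add_zero]
      exact map_mem_degSpace inl hv.mem_degSpace
    have hind : iSupIndep fun k : ℕ => degSpace (V × W) (topDeg lam + k) :=
      iSupIndep_degSpace.comp fun a b hab => by simpa using hab
    have h0 : (v, (0 : W)) ∈ words (v, t) 0 :=
      inf_iSup_le_of_iSupIndep hind (words_le_degSpace hz.mem_degSpace) 0 ⟨hdeg, hv0⟩
    obtain ⟨a, ha⟩ := Submodule.mem_span_singleton.1 h0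
    have ha2 : a • t = 0 := congrArg Prod.snd ha
    have ha1 : a • v = v := congrArg Prod.fst ha
    rw [(smul_eq_zero.1 ha2).resolve_right ht.ne_zero, zero_smul] at ha1
    exact hv.ne_zero ha1.symm
  have hmaps : ∀ x ∈ filtration (words (v, t)) j, (snd : V × W →ₗ[ℂ] W) x ∈
      filtration (words t) j := by
    intro x hx
    have := Submodule.mem_map_of_mem (f := (snd : V × W →ₗ[ℂ] W)) hx
    rwa [map_filtration_words] at this
  let g := (snd : V × W →ₗ[ℂ] W).restrict hmaps
  have hg : Function.Injective g := by
    rw [← LinearMap.ker_eq_bot, LinearMap.ker_eq_bot']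
    rintro ⟨⟨x, y⟩, hx⟩ h
    obtain rfl : y = 0 := congrArg Subtype.val h
    have hle : filtration (words (v, t)) j ≤ ⨆ k, words (v, t) k :=
      iSup₂_le fun k _ => le_iSup (words (v, t)) k
    obtain rfl := hinj x (hle hx)
    rfl
  have : FiniteDimensional ℂ (filtration (words (v, t)) j) := Module.Finite.of_injective g hg
  calc Module.finrank ℂ (filtration (words v) j)
      = Module.finrank ℂ ((filtration (words (v, t)) j).map (fst : V × W →ₗ[ℂ] V)) := by
        rw [map_filtration_words]
        rfl
    _ ≤ Module.finrank ℂ (filtration (words (v, t)) j) := Submodule.finrank_map_le _ _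
    _ ≤ _ := LinearMap.finrank_le_finrank_of_injective hg

end Comparison

/-! ### The upper bound for the growth -/

section PolynomialBound

open scoped Pointwise

/-- The span of the variables `x_{ia}` with `i ≤ J` and `a < N`. -/
def varSpan (J N : ℕ) : Submodule ℂ MatPoly :=
  Submodule.span ℂ (X '' (Set.Iic J ×ˢ Set.Iio N))

theorem X_mem_varSpan {J N i a : ℕ} (hi : i ≤ J) (ha : a < N) :
    (X (i, a) : MatPoly) ∈ varSpan J N :=
  Submodule.subset_span ⟨(i, a), ⟨hi, ha⟩, rfl⟩

theorem varSpan_mono {J J' : ℕ} (h : J ≤ J') (N : ℕ) : varSpan J N ≤ varSpan J' N :=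
  Submodule.span_mono (Set.image_mono (Set.prod_mono (Set.Iic_subset_Iic.2 h) le_rfl))

theorem varSpan_pow_finite_and_finrank_le (J N n : ℕ) :
    FiniteDimensional ℂ (varSpan J N ^ n : Submodule ℂ MatPoly) ∧
      Module.finrank ℂ (varSpan J N ^ n : Submodule ℂ MatPoly) ≤ ((J + 1) * N) ^ n := by
  classical
  let s : Finset MatPoly := (Finset.Iic J ×ˢ Finset.Iio N).image X
  have hs : varSpan J N ^ n = Submodule.span ℂ ((s ^ n : Finset MatPoly) : Set MatPoly) := by
    rw [Finset.coe_pow, ← Submodule.span_pow, varSpan]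
    simp [s]
  rw [hs]
  refine ⟨inferInstance, (finrank_span_finset_le_card _).trans ?_⟩
  refine Finset.card_pow_le.trans (Nat.pow_le_pow_left ?_ n)
  refine Finset.card_image_le.trans ?_
  simp

theorem prod_mem_pow_sum {A : Type*} [CommRing A] [Algebra ℂ A] {S : Submodule ℂ A} {ι : Type*}
    (s : Finset ι) (f : ι → A) (e : ι → ℕ) (h : ∀ i ∈ s, f i ∈ S ^ e i) :
    ∏ i ∈ s, f i ∈ S ^ ∑ i ∈ s, e i := by
  classical
  induction s using Finset.induction_on with
  | empty =>
    rw [Finset.prod_empty, Finset.sum_empty, pow_zero, Submodule.mem_one]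
    exact ⟨1, map_one _⟩
  | insert a s ha ih =>
    rw [Finset.prod_insert ha, Finset.sum_insert ha, pow_add]
    exact Submodule.mul_mem_mul (h a (Finset.mem_insert_self a s))
      (ih fun i hi => h i (Finset.mem_insert_of_mem hi))

/-- A derivation that maps `S` into a larger space `T` maps `S ^ n` into `T ^ n`. -/
theorem derivation_mem_pow {A : Type*} [CommRing A] [Algebra ℂ A] (D : Derivation ℂ A A)
    {S T : Submodule ℂ A} (hST : S ≤ T) (hD : ∀ x ∈ S, D x ∈ T) (n : ℕ) :
    ∀ x ∈ S ^ n, D x ∈ T ^ n := by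
  induction n with
  | zero =>
    intro x hx
    rw [pow_zero, Submodule.mem_one] at hx
    obtain ⟨c, rfl⟩ := hx
    rw [Derivation.map_algebraMap]
    exact zero_mem _
  | succ n ih =>
    intro x hx
    rw [pow_succ] at hx ⊢
    refine Submodule.mul_induction_on hx (fun y hy z hz => ?_) fun y z hy hz => ?_
    · rw [D.leibniz, smul_eq_mul, smul_eq_mul, mul_comm z]
      exact add_mem (Submodule.mul_mem_mul (pow_le_pow_left' hST n hy) (hD z hz))
        (Submodule.mul_mem_mul (ih y hy) (hST hz))
    · rw [map_add]
      exact add_mem hy hz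

theorem leadingMinor_mem_varSpan_pow {k N : ℕ} (hk : k ≤ N) :
    leadingMinor k ∈ varSpan N N ^ k := by
  rw [leadingMinor, Matrix.det_apply]
  refine Submodule.sum_mem _ fun σ _ => ?_
  rw [Units.smul_def]
  refine zsmul_mem ?_ _
  have := prod_mem_pow_sum (S := varSpan N N) Finset.univ
    (fun i => genericBlock k (σ i) i) (fun _ => 1) fun i _ => by
      rw [pow_one]
      exact X_mem_varSpan (by omega) (by omega)
  simpa using this

theorem lowering_mem_varSpan_pow {J N n : ℕ} (i : ℕ) {f : MatPoly} (hf : f ∈ varSpan J N ^ n) :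
    polyAction (E (i + 1) i) f ∈ varSpan (J + 1) N ^ n := by
  refine derivation_mem_pow _ (varSpan_mono (Nat.le_succ J) N) (fun x hx => ?_) n f hf
  induction hx using Submodule.span_induction with
  | mem x hx =>
    obtain ⟨⟨b, a⟩, ⟨hb, ha⟩, rfl⟩ := hx
    rw [polyAction_E_X]
    split_ifs with h
    · subst h
      exact X_mem_varSpan (Nat.succ_le_succ hb) ha
    · exact zero_mem _
  | zero => simp
  | add x y _ _ hx hy => rw [map_add]; exact add_mem hx hy
  | smul c x _ hx => rw [Derivation.map_smul]; exact Submodule.smul_mem _ c hx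

/-- The product of the leading minors of size `k + 1` to the powers `a_k - a_{k+1}` has degree
`∑ a_k`. -/
theorem sum_succ_mul_sub {a : ℕ → ℕ} (ha : Antitone a) (N : ℕ) :
    ∑ k ∈ Finset.range N, (k + 1) * (a k - a (k + 1)) + N * a N = ∑ k ∈ Finset.range N, a k := by
  induction N with
  | zero => simp
  | succ N ih =>
    rw [Finset.sum_range_succ, Finset.sum_range_succ, ← ih]
    obtain ⟨d, hd⟩ := Nat.exists_eq_add_of_le (ha (Nat.le_succ N))
    rw [hd, Nat.add_sub_cancel_left]
    ring

end PolynomialBound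

/-- The irreducible module of weight `λ ∈ Par⁺` is a quotient of a module of polynomials of degree
`n = |λ|` in which applying `E_{i+1,i}` increases the row indices of the variables by at most
one. -/
theorem growth_le_of_antitone {V : Type*} [AddCommGroup V] [Module ℂ V] [LieRingModule gl V]
    [LieModule ℂ gl V] [LieModule.IsIrreducible ℂ gl V] {lam : ℕ →₀ ℂ} {v : V}
    (hv : IsHighestWeightVector lam v) {N n : ℕ} (hN : ∀ i, N ≤ i → lam i = 0) {a : ℕ → ℕ}
    (hmono : Antitone a) (ha : ∀ i, lam i = a i) (hn : ∑ i ∈ Finset.range N, a i = n) :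
    growth (filtration (words v)) ≤ n := by
  let := polyLieRingModule
  have := polyLieModule
  set t : MatPoly := ∏ k ∈ Finset.range N, leadingMinor (k + 1) ^ (a k - a (k + 1)) with ht
  have htw : IsHighestWeightVector lam t :=
    isHighestWeightVector_prod_leadingMinor hN fun k => by
      rw [ha, ha, Nat.cast_sub (hmono (Nat.le_succ k))]
  have haN : a N = 0 := by
    have := hN N le_rfl
    rw [ha] at this
    exact_mod_cast this
  have htn : t ∈ varSpan N N ^ n := by
    rw [← hn, ← sum_succ_mul_sub hmono N, haN, mul_zero, add_zero]
    refine prod_mem_pow_sum _ _ _ fun k hk => ?_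
    rw [pow_mul]
    exact Submodule.pow_mem_pow _ (leadingMinor_mem_varSpan_pow (Finset.mem_range.1 hk)) _
  have hwords : ∀ k, words t k ≤ varSpan (N + k) N ^ n := by
    intro k
    induction k with
    | zero => simpa [words] using htn
    | succ k ih => exact words_succ_le fun i x hx => lowering_mem_varSpan_pow i (ih hx)
  have hfil : ∀ j, filtration (words t) j ≤ varSpan (N + j) N ^ n := fun j =>
    iSup₂_le fun k hk => (hwords k).trans
      (pow_le_pow_left' (varSpan_mono (Nat.add_le_add_left hk N) N) n)
  refine growth_le (c := (((N + 2) * N + 1 : ℕ) : ℝ) ^ n) (one_le_pow₀ ?_) ?_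
  · exact_mod_cast Nat.le_add_left 1 _
  filter_upwards [Filter.eventually_ge_atTop 1] with j hj
  obtain ⟨hfin, hle⟩ := varSpan_pow_finite_and_finrank_le (N + j) N n
  have := Submodule.finiteDimensional_of_le (hfil j)
  have h1 := (finrank_filtration_le hv htw j).trans ((Submodule.finrank_mono (hfil j)).trans hle)
  have h2 : (N + j + 1) * N ≤ ((N + 2) * N + 1) * j := by
    have : N + j + 1 ≤ (N + 2) * j := by nlinarith
    calc (N + j + 1) * N ≤ (N + 2) * j * N := Nat.mul_le_mul_right N this
      _ ≤ ((N + 2) * N + 1) * j := by nlinarith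
  rw [← mul_pow]
  exact_mod_cast h1.trans (Nat.pow_le_pow_left h2 n)

theorem exists_natCast_of_mem_Par {lam : ℕ →₀ ℂ} (h : lam ∈ Par) :
    ∃ a : ℕ → ℕ, Antitone a ∧ ∀ i, lam i = a i := by
  obtain ⟨μ, hμ, hlam⟩ := h
  obtain ⟨m, -, hm⟩ := exists_forall_ge_eq_zero lam 0
  have h0 : ∀ i, 0 ≤ μ i := by
    intro i
    have h1 : μ (max i m) = 0 := by
      have := hlam (max i m)
      rw [hm _ (le_max_right i m)] at this
      exact_mod_cast this.symm
    exact h1 ▸ hμ (le_max_left i m)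
  refine ⟨fun i => (μ i).toNat, fun i j hij => Int.toNat_le_toNat (hμ hij), fun i => ?_⟩
  rw [hlam i]
  exact_mod_cast congrArg (Int.cast : ℤ → ℂ) (Int.toNat_of_nonneg (h0 i)).symm

theorem size_eq_sum {lam : ℕ →₀ ℂ} {N : ℕ} (hN : ∀ i, N ≤ i → lam i = 0) :
    size lam = ∑ i ∈ Finset.range N, lam i := by
  refine Finsupp.sum_of_support_subset _ (fun i hi => ?_) _ (by simp)
  rw [Finset.mem_range]
  by_contra h
  exact Finsupp.mem_support_iff.1 hi (hN i (by omega))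

end
end GLInf

theorem mainTheorem9 (lam : ℕ →₀ ℂ) :
    (∃ (V : Type) (_ : AddCommGroup V) (_ : Module ℂ V) (_ : LieRingModule GLInf.gl V)
        (_ : LieModule ℂ GLInf.gl V) (v : V),
        LieModule.IsIrreducible ℂ GLInf.gl V ∧ GLInf.IsHighestWeightVector lam v) ∧
    ∀ (V : Type*) [AddCommGroup V] [Module ℂ V] [LieRingModule GLInf.gl V]
        [LieModule ℂ GLInf.gl V] (v : V),
        LieModule.IsIrreducible ℂ GLInf.gl V → GLInf.IsHighestWeightVector lam v →
        (∃! G : ℕ → Submodule ℂ V, GLInf.IsPrincipalGradation v G) ∧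
        ∀ G : ℕ → Submodule ℂ V, GLInf.IsPrincipalGradation v G →
          (∀ k, FiniteDimensional ℂ (G k)) ∧
          (lam ∈ GLInf.Par → ∃ n : ℕ, (n : ℂ) = GLInf.size lam ∧
            GLInf.growth (GLInf.filtration G) = (n : EReal)) ∧
          (lam ∉ GLInf.Par → GLInf.growth (GLInf.filtration G) = ⊤) := by
  refine ⟨?_, fun V _ _ _ _ v hirr hv => ?_⟩
  · obtain ⟨V, _, _, _, _, v, hv⟩ := GLInf.exists_highestWeightVector lam
    exact GLInf.exists_irreducible hv
  refine ⟨⟨GLInf.words v, GLInf.isPrincipalGradation_words hv, fun G hG => hG.eq_words hv⟩, ?_⟩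
  intro G hG
  obtain rfl := hG.eq_words hv
  refine ⟨GLInf.finiteDimensional_words hv, fun hlam => ?_, GLInf.growth_eq_top hv⟩
  obtain ⟨a, hmono, ha⟩ := GLInf.exists_natCast_of_mem_Par hlam
  obtain ⟨N, -, hN⟩ := GLInf.exists_forall_ge_eq_zero lam 0
  refine ⟨∑ i ∈ Finset.range N, a i, ?_, le_antisymm
    (GLInf.growth_le_of_antitone hv hN hmono ha rfl)
    (GLInf.natCast_le_growth_of_sum_eq hv hN ha rfl)⟩
  rw [GLInf.size_eq_sum hN]
  simp [ha]
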